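/- **Fading models.** Let $N\ge 0$, $V_1,\dots,V_N\ge 0$, $m>0$, $\Omega>0$, $\gamma_0>0$. Let $\phi_1,\dots,\phi_N,\phi_d$ be uniform on $[0,2\pi]$, let $V_d$ have the Nakagami-$m$ density $\frac{2}{\Gamma(m)}\left(\frac m\Omega\right)^m x^{2m-1}e^{-mx^2/\Omega}$ on $(0,\infty)$, and, for $m_s>0$, let $\xi$ have the Gamma density $\frac{m_s^{m_s}}{\Gamma(m_s)}u^{m_s-1}e^{-m_su}$ on $(0,\infty)$; all these random variables are independent. The envelope is $$R=\Big|\sum_{i=1}^N V_ie^{j\phi_i}+V_de^{j\phi_d}\Big|\ \text{(MWGD model)},\qquad R=\Big|\sum_{i=1}^N \sqrt{\xi}\,V_ie^{j\phi_i}+V_de^{j\phi_d}\Big|\ \text{(FMR model)}.$$ Put $\gamma=\gamma_0R^2$, $\epsilon^{-1}=\sum_iV_i^2+\Omega$, $\bar\gamma=\gamma_0\left(\sum_iV_i^2+\Omega\right)$ and $C_n=\mathbb E[L_n(\epsilon R^2)]$, where $L_n(x)=\sum_{k=0}^n\frac{(-1)^k}{k!}\binom nk x^k$ is the Laguerre polynomial.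 For finitely many constants $\alpha_r\in\mathbb R$, $\beta_r>0$ let $P_E(\gamma)=\sum_r\alpha_rQ(\sqrt{\beta_r\gamma})$ with $Q(x)=\frac1{\sqrt{2\pi}}\int_x^\infty e^{-t^2/2}\,dt$, and let $(x)_a=\Gamma(x+a)/\Gamma(x)$. **Statement.** For both models, the average bit error rate is $$\mathbb E[P_E(\gamma)]=\sum_{r}\alpha_r\sqrt{\frac{\beta_r\bar\gamma}{8\pi}}\sum_{n=0}^\infty C_n\sum_{k=0}^n\frac{(-1)^k}{\left(k+\frac32\right)_{1/2}}\binom nk\,\frac{{}_2F_1\!\left(1,k+\frac32;k+2;\frac1{1+\beta_r\bar\gamma/2}\right)}{\left(1+\beta_r\bar\gamma/2\right)^{k+3/2}}$$ in the following sense. 1. For all values of the parameters above, the equality holds whenever, for each $r$, the series over $n$ converges (as a limit of partial sums). 2. For each $r$ the series over $n$ converges absolutely, and the equality holds, in the MWGD model if $\Omega<2m\left(\sum_iV_i^2+\Omega\right)$ (for instance if $m\ge\frac12$ and some $V_i>0$), and in the FMR model if $\left(\sum_iV_i\right)^2<m_s\left(2\sum_iV_i^2+2\Omega-\frac{\Omega}{m}\right)$.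 -/

import Mathlib

open MeasureTheory ProbabilityTheory Filter Topology

noncomputable section

/-- The Nakagami-`m` law with shape `m` and spread `Ω`: density
`2 / Γ(m) * (m / Ω) ^ m * x ^ (2 m - 1) * exp (- m x² / Ω)` on `(0, ∞)`. -/
def nakagamiMeasure (m Ω : ℝ) : Measure ℝ :=
  volume.withDensity fun x => ENNReal.ofReal
    (if 0 < x then
      2 / Real.Gamma m * (m / Ω) ^ m * x ^ (2 * m - 1) * Real.exp (-(m / Ω) * x ^ 2)
    else 0)

/-- The uniform law on `[0, 2π]`. -/
def uniformPhase : Measure ℝ := ProbabilityTheory.cond volume (Set.Icc 0 (2 * Real.pi))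

/-- `R` is the envelope of a signal of the MWGD model: `R = |∑ᵢ Vᵢ e^{jφᵢ} + V_d e^{jφ_d}|` with
independent phases `φᵢ`, `φ_d` uniform on `[0, 2π]` and an independent diffuse amplitude `V_d`
with the Nakagami-`m` law. -/
def IsMWGDEnvelope {S : Type*} [MeasurableSpace S] (P : Measure S) {N : ℕ} (V : Fin N → ℝ)
    (m Ω : ℝ) (R : S → ℝ) : Prop :=
  ∃ (φ : Fin N → S → ℝ) (φd Vd : S → ℝ),
    (∀ i, HasLaw (φ i) uniformPhase P) ∧ HasLaw φd uniformPhase P ∧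
    HasLaw Vd (nakagamiMeasure m Ω) P ∧
    iIndepFun (Sum.elim φ ![φd, Vd]) P ∧
    ∀ᵐ s ∂P, R s = ‖∑ i, (V i : ℂ) * Complex.exp (Complex.I * φ i s) +
      (Vd s : ℂ) * Complex.exp (Complex.I * φd s)‖

/-- `R` is the envelope of a signal of the FMR model:
`R = |∑ᵢ √ξ Vᵢ e^{jφᵢ} + V_d e^{jφ_d}|` with phases and diffuse amplitude as in the MWGD model and
a common independent fluctuation `ξ` with the Gamma law of shape `ms` and rate `ms`. -/
def IsFMREnvelope {S : Type*} [MeasurableSpace S] (P : Measure S) {N : ℕ} (V : Fin N → ℝ)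
    (m Ω ms : ℝ) (R : S → ℝ) : Prop :=
  ∃ (φ : Fin N → S → ℝ) (φd Vd ξ : S → ℝ),
    (∀ i, HasLaw (φ i) uniformPhase P) ∧ HasLaw φd uniformPhase P ∧
    HasLaw Vd (nakagamiMeasure m Ω) P ∧ HasLaw ξ (gammaMeasure ms ms) P ∧
    iIndepFun (Sum.elim φ ![φd, Vd, ξ]) P ∧
    ∀ᵐ s ∂P, R s = ‖∑ i, (Real.sqrt (ξ s) : ℂ) * (V i : ℂ) * Complex.exp (Complex.I * φ i s) +
      (Vd s : ℂ) * Complex.exp (Complex.I * φd s)‖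

/-- Total mean power `∑ᵢ Vᵢ² + Ω`; its inverse is the constant `ε`. -/
def totalPower {N : ℕ} (V : Fin N → ℝ) (Ω : ℝ) : ℝ := ∑ i, V i ^ 2 + Ω

/-- The average SNR `γ̄ = γ₀ (∑ᵢ Vᵢ² + Ω)`. -/
def avgSNR {N : ℕ} (V : Fin N → ℝ) (Ω γ₀ : ℝ) : ℝ := γ₀ * totalPower V Ω

/-- The Laguerre polynomial `L_n`. -/
def laguerreL (n : ℕ) (x : ℝ) : ℝ :=
  ∑ k ∈ Finset.range (n + 1), (-1) ^ k / (k.factorial : ℝ) * (n.choose k : ℝ) * x ^ k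

/-- The coefficient `C_n = E[L_n(ε R²)]` with `ε = 1 / (∑ᵢ Vᵢ² + Ω)`. -/
def laguerreCoeff {S : Type*} [MeasurableSpace S] (P : Measure S) {N : ℕ} (V : Fin N → ℝ)
    (Ω : ℝ) (R : S → ℝ) (n : ℕ) : ℝ :=
  ∫ s, laguerreL n (1 / totalPower V Ω * R s ^ 2) ∂P

/-- The Gauss Q-function. -/
def gaussQ (x : ℝ) : ℝ :=
  1 / Real.sqrt (2 * Real.pi) * ∫ t in Set.Ioi x, Real.exp (-t ^ 2 / 2)

/-- The instantaneous bit error rate `P_E(γ) = ∑_r α_r Q(√(β_r γ))`. -/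
def instBER {M : ℕ} (α β : Fin M → ℝ) (γ : ℝ) : ℝ :=
  ∑ r, α r * gaussQ (Real.sqrt (β r * γ))

/-- The Pochhammer symbol `(x)_a = Γ(x + a) / Γ(x)` with real index `a`. -/
def realPochhammer (x a : ℝ) : ℝ := Real.Gamma (x + a) / Real.Gamma x

/-- With `b = β γ̄`, the sum over `k ≤ n` of
`(-1)^k / (k+3/2)_{1/2} * binom(n,k) * ₂F₁(1, k+3/2; k+2; 1/(1+b/2)) / (1+b/2)^(k+3/2)`. -/
def berInnerSum (b : ℝ) (n : ℕ) : ℝ :=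
  ∑ k ∈ Finset.range (n + 1),
    (-1) ^ k / realPochhammer ((k : ℝ) + 3 / 2) (1 / 2) * (n.choose k : ℝ) *
      (ordinaryHypergeometric (1 : ℝ) ((k : ℝ) + 3 / 2) ((k : ℝ) + 2) (1 / (1 + b / 2)) /
        (1 + b / 2) ^ ((k : ℝ) + 3 / 2))

end

/-! Put `X = ε R²` and `b = β γ̄`. Craig's representation writes `gaussQ (√(b x))` as a mixture of
exponentials `exp (-λ x)`, where `λ = b / 2 * (1 + s²)` and `s` follows half the Cauchy law. With `u
= λ / (1 + λ)`, the Laguerre generating function gives `exp (-λ x) = (1 - u) ∑ uⁿ L_n(x)`.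
Integrating over `s` and over the law of `X` yields formally `∑ C_n D_n` with `D_n = ∫ uⁿ (1 - u)`,
and `D_n` is the hypergeometric inner sum times `√(b / (8π))`.

Absolute convergence: `∑ uⁿ (1 - u) |L_n(x)| ≤ exp (x / 2)` uniformly in `u`, by Parseval on circles
and Cauchy–Schwarz. Hence `E[exp (X / 2)] < ∞` suffices (`summable_integral_laguerreL_mul`), and the
stated parameter ranges guarantee it.

The equality (`integral_integral_exp_eq_of_tendsto`) needs only some exponential moment of `X` and
convergence of the series. Then `C_n D_n → 0`, while `D_n` decays more slowly than any geometric
sequence because `u` comes arbitrarily close to `1`. So `∑ C_n uⁿ` has radius at least `1`, and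
analytic continuation from a neighbourhood of `0` identifies it on `[0, 1)` with `(1 - u)⁻¹ E[exp
(-u / (1 - u) X)]`. Abel's limit theorem then gives the value of the original series. -/

noncomputable section

/-! ### Laguerre polynomials and their generating function. -/

/-- The polynomial `∑ k ≤ n, (n choose k) * y ^ k / k!`, that is, the Laguerre polynomial
at `-y`. -/
def laguerreNeg (n : ℕ) (y : ℂ) : ℂ :=
  ∑ k ∈ Finset.range (n + 1), (n.choose k : ℂ) * y ^ k / (k.factorial : ℂ)

theorem laguerreNeg_neg_ofReal (n : ℕ) (x : ℝ) : laguerreNeg n (-(x : ℂ)) = laguerreL n x := by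
  simp only [laguerreNeg, laguerreL]
  push_cast
  refine Finset.sum_congr rfl fun k _ => ?_
  rw [neg_pow]
  ring

/-- Expand the exponential, then each `(1 - t)⁻⁽ᵏ⁺¹⁾` by the negative binomial series. The double
series converges absolutely, so it may be regrouped along `j + k = n`. -/
theorem hasSum_laguerreNeg {t : ℂ} (ht : ‖t‖ < 1) (y : ℂ) :
    HasSum (fun n => t ^ n * laguerreNeg n y)
      ((1 - t)⁻¹ * Complex.exp (t * y / (1 - t))) := by
  have key : ∀ (t y : ℂ), ‖t‖ < 1 → HasSum
      (fun k : ℕ => 1 / (1 - t) ^ (k + 1) * ((t * y) ^ k / (k.factorial : ℂ)))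
      ((1 - t)⁻¹ * Complex.exp (t * y / (1 - t))) := by
    intro t y ht
    have h1 : (1 - t) ≠ 0 := by
      intro h
      have : t = 1 := by linear_combination -h
      simp [this] at ht
    have := (NormedSpace.expSeries_div_hasSum_exp (𝔸 := ℂ) (t * y / (1 - t)))
    rw [← Complex.exp_eq_exp_ℂ] at this
    convert! this.mul_left ((1 - t)⁻¹) using 1
    ext k
    rw [div_pow, pow_succ]
    field_simp
  obtain ⟨F, hF⟩ : ∃ F : ℕ × ℕ → ℂ, ∀ p, F p =
      ((p.2 + p.1).choose p.1 : ℂ) * t ^ p.2 * ((t * y) ^ p.1 / (p.1.factorial : ℂ)) :=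
    ⟨_, fun _ => rfl⟩
  have hrow : ∀ k, HasSum (fun j => F (k, j))
      (1 / (1 - t) ^ (k + 1) * ((t * y) ^ k / (k.factorial : ℂ))) := fun k => by
    simp only [hF]
    exact (hasSum_choose_mul_geometric_of_norm_lt_one k ht).mul_right _
  have hnorm : Summable fun p => ‖F p‖ := by
    have hr : ∀ k, HasSum (fun j => ‖F (k, j)‖)
        (1 / (1 - ‖t‖) ^ (k + 1) * (‖t * y‖ ^ k / (k.factorial : ℝ))) := fun k => by
      have := (hasSum_choose_mul_geometric_of_norm_lt_one (𝕜 := ℝ) (r := ‖t‖) k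
        (by simpa using ht)).mul_right (‖t * y‖ ^ k / (k.factorial : ℝ))
      simpa [hF] using this
    refine (summable_prod_of_nonneg fun _ => norm_nonneg _).2
      ⟨fun k => (hr k).summable, ?_⟩
    simp_rw [fun k => (hr k).tsum_eq]
    -- The norms form the same double series at `‖t‖`, `‖y‖`.
    have := ((key (‖t‖ : ℂ) (‖y‖ : ℂ) (by simpa using ht)).summable).norm
    refine this.congr fun k => ?_
    have h0 : (0 : ℝ) < 1 - ‖t‖ := by linarith
    have h1 : ‖(1 : ℂ) - (‖t‖ : ℂ)‖ = 1 - ‖t‖ := by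
      rw [← Complex.ofReal_one, ← Complex.ofReal_sub, Complex.norm_real, Real.norm_of_nonneg h0.le]
    simp [h1]
  have hsum : HasSum F ((1 - t)⁻¹ * Complex.exp (t * y / (1 - t))) := by
    have h1 := hnorm.of_norm.hasSum
    have h2 := h1.prod_fiberwise hrow
    rwa [h2.unique (key t y ht)] at h1
  have h3 := (Finset.HasAntidiagonal.sigmaAntidiagonalEquivProd (A := ℕ)).hasSum_iff.2 hsum
  have h4 := h3.sigma (fun n => hasSum_fintype _)
  convert! h4 using 1
  ext n
  rw [Finset.univ_eq_attach]
  refine Eq.trans ?_ (Finset.sum_attach (Finset.HasAntidiagonal.antidiagonal n) F).symm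
  rw [Finset.Nat.sum_antidiagonal_eq_sum_range_succ_mk, laguerreNeg, Finset.mul_sum]
  refine Finset.sum_congr rfl fun k hk => ?_
  have hkn : k ≤ n := Nat.lt_succ_iff.1 (Finset.mem_range.1 hk)
  simp only [hF, Nat.sub_add_cancel hkn]
  rw [mul_pow, show t ^ n = t ^ (n - k) * t ^ k by rw [← pow_add, Nat.sub_add_cancel hkn]]
  ring

theorem hasSum_laguerreL {u : ℝ} (hu : |u| < 1) (x : ℝ) :
    HasSum (fun n => u ^ n * laguerreL n x) ((1 - u)⁻¹ * Real.exp (-(u / (1 - u)) * x)) := by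
  have h := hasSum_laguerreNeg (t := (u : ℂ)) (by simpa using hu) (-(x : ℂ))
  simp_rw [laguerreNeg_neg_ofReal] at h
  rw [← Complex.hasSum_ofReal]
  convert! h using 1
  · ext n
    push_cast
    rfl
  · push_cast
    congr 2
    ring

theorem abs_laguerreL_le (n : ℕ) (x : ℝ) : |laguerreL n x| ≤ laguerreL n (-|x|) := by
  unfold laguerreL
  refine (Finset.abs_sum_le_sum_abs _ _).trans (Finset.sum_le_sum fun k _ => le_of_eq ?_)
  rw [abs_mul, abs_mul, abs_div, abs_pow, abs_pow, neg_pow (|x|)]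
  simp only [abs_neg, abs_one, one_pow, Nat.abs_cast]
  have : ((-1 : ℝ) ^ k) * (-1) ^ k = 1 := by rw [← mul_pow]; norm_num
  linear_combination (-(1 / (k.factorial : ℝ)) * n.choose k * |x| ^ k) * this

theorem continuous_laguerreL (n : ℕ) : Continuous (laguerreL n) := by
  unfold laguerreL
  fun_prop

/-! ### Parseval's identity and a uniform bound for Laguerre series. -/

theorem continuous_tsum_mul_circleMap_pow {a : ℕ → ℂ} (ha : Summable fun n => ‖a n‖) :
    Continuous fun θ : ℝ => ∑' n, a n * circleMap 0 1 θ ^ n := by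
  refine continuous_tsum (fun n => by fun_prop) ha fun n θ => ?_
  simp

/-- Parseval's identity for absolutely convergent power series on the unit circle. -/
theorem hasSum_sq_norm_circleAverage {a : ℕ → ℂ} (ha : Summable fun n => ‖a n‖) :
    HasSum (fun n => ‖a n‖ ^ 2)
      (Real.circleAverage (fun z => ‖∑' n, a n * z ^ n‖ ^ 2) 0 1) := by
  -- Polynomial Parseval for the partial sums; the limit passes under the circle average with the
  -- constant bound `(∑ ‖a n‖)²`.
  have hpart : ∀ N : ℕ, ∑ n ∈ Finset.range N, ‖a n‖ ^ 2 =
      Real.circleAverage (fun z => ‖∑ n ∈ Finset.range N, a n * z ^ n‖ ^ 2) 0 1 := by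
    intro N
    set p : Polynomial ℂ := ∑ n ∈ Finset.range N, Polynomial.monomial n (a n) with hp
    have hc : ∀ n, p.coeff n = if n < N then a n else 0 := by
      intro n
      simp [hp, Polynomial.coeff_monomial]
    have h := p.sum_sq_norm_coeff_eq_circleAverage
    have he : ∀ z, p.eval z = ∑ n ∈ Finset.range N, a n * z ^ n := by
      intro z
      simp [hp, Polynomial.eval_finsetSum]
    simp_rw [he] at h
    rw [← h]
    symm
    have hsub : p.support ⊆ Finset.range N := by
      intro n hn
      rw [Polynomial.mem_support_iff, hc] at hn
      rw [Finset.mem_range]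
      by_contra hN
      simp [hN] at hn
    rw [Finset.sum_subset hsub]
    · refine Finset.sum_congr rfl fun n hn => ?_
      rw [hc, if_pos (Finset.mem_range.1 hn)]
    · intro n _ hn
      rw [Polynomial.notMem_support_iff.1 hn]
      simp
  have hnorm : ∀ (θ : ℝ) (n : ℕ), ‖a n * circleMap 0 1 θ ^ n‖ = ‖a n‖ := by
    intro θ n
    simp
  have hlim : Tendsto (fun N : ℕ => ∑ n ∈ Finset.range N, ‖a n‖ ^ 2) atTop
      (𝓝 (Real.circleAverage (fun z => ‖∑' n, a n * z ^ n‖ ^ 2) 0 1)) := by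
    simp_rw [hpart, Real.circleAverage]
    refine Tendsto.const_smul ?_ _
    refine intervalIntegral.tendsto_integral_filter_of_dominated_convergence
      (fun _ => (∑' n, ‖a n‖) ^ 2) ?_ ?_ ?_ ?_
    · refine Eventually.of_forall fun N => Continuous.aestronglyMeasurable ?_
      fun_prop
    · refine Eventually.of_forall fun N => Eventually.of_forall fun θ _ => ?_
      rw [Real.norm_of_nonneg (by positivity)]
      gcongr
      refine (norm_sum_le _ _).trans ?_
      simp_rw [hnorm]
      exact ha.sum_le_tsum _ fun n _ => norm_nonneg _
    · simp
    · refine Eventually.of_forall fun θ _ => ?_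
      have hs : Summable fun n => a n * circleMap 0 1 θ ^ n :=
        Summable.of_norm (by simpa only [hnorm] using ha)
      exact (hs.hasSum.tendsto_sum_nat.norm).pow 2
  exact (hasSum_iff_tendsto_nat_of_nonneg (fun n => by positivity) _).2 hlim

/-- The Möbius map `t ↦ -t / (1 - t)` sends the unit disc to the half-plane `Re < 1/2`; this is the
origin of the exponent `1/2` in the moment condition. -/
theorem re_neg_div_one_sub_le {t : ℂ} (ht : ‖t‖ < 1) : (-(t / (1 - t))).re ≤ 1 / 2 := by
  have h1 : (1 - t) ≠ 0 := by
    intro h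
    have : t = 1 := by linear_combination -h
    simp [this] at ht
  have hpos : 0 < Complex.normSq (1 - t) := Complex.normSq_pos.2 h1
  have hn : Complex.normSq t ≤ 1 := by
    rw [Complex.normSq_eq_norm_sq]
    nlinarith [norm_nonneg t]
  rw [Complex.neg_re, Complex.div_re, ← add_div, ← neg_div, div_le_iff₀ hpos]
  simp only [Complex.normSq_apply, Complex.sub_re, Complex.sub_im, Complex.one_re,
    Complex.one_im] at hn ⊢
  nlinarith

theorem norm_laguerre_generating_sq_le {t : ℂ} (ht : ‖t‖ < 1) {x : ℝ} (hx : 0 ≤ x) :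
    ‖(1 - t)⁻¹ * Complex.exp (t * (-(x : ℂ)) / (1 - t))‖ ^ 2 ≤
      Real.exp x * ‖(1 - t)⁻¹‖ ^ 2 := by
  rw [norm_mul, mul_pow, mul_comm, Complex.norm_exp, ← Real.exp_nat_mul]
  gcongr
  have h : t * (-(x : ℂ)) / (1 - t) = -(t / (1 - t)) * x := by ring
  rw [h, Complex.re_mul_ofReal]
  push_cast
  nlinarith [re_neg_div_one_sub_le ht]

/-- On the circle of radius `r` the generating function is at most `exp (x / 2)` times the geometric
series in modulus; Parseval turns this into a comparison of square sums of coefficients. -/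
theorem sum_pow_mul_laguerreL_sq_le {r : ℝ} (hr0 : 0 ≤ r) (hr : r < 1) {x : ℝ} (hx : 0 ≤ x)
    (N : ℕ) :
    ∑ n ∈ Finset.range N, (r ^ n * laguerreL n x) ^ 2 ≤ Real.exp x / (1 - r ^ 2) := by
  have hra : |r| < 1 := by rwa [abs_of_nonneg hr0]
  have hr2 : r ^ 2 < 1 := by nlinarith
  set a : ℕ → ℂ := fun n => ((r ^ n * laguerreL n x : ℝ) : ℂ) with ha_def
  set g : ℕ → ℂ := fun n => ((r ^ n : ℝ) : ℂ) with hg_def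
  have hg : Summable fun n => ‖g n‖ := by
    simpa [hg_def] using summable_geometric_of_lt_one (abs_nonneg r) hra
  have ha : Summable fun n => ‖a n‖ := by
    simp only [ha_def, Complex.norm_real]
    exact (hasSum_laguerreL hra x).summable.norm
  have hgsum : Real.circleAverage (fun z => ‖∑' n, g n * z ^ n‖ ^ 2) 0 1 = 1 / (1 - r ^ 2) := by
    refine (hasSum_sq_norm_circleAverage hg).unique ?_
    have := hasSum_geometric_of_lt_one (sq_nonneg r) hr2
    rw [one_div]
    convert! this using 2 with n
    simp only [hg_def, Complex.norm_real, Real.norm_eq_abs, sq_abs]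
    ring
  have hmono : Real.circleAverage (fun z => ‖∑' n, a n * z ^ n‖ ^ 2) 0 1 ≤
      Real.circleAverage (fun z => Real.exp x • ‖∑' n, g n * z ^ n‖ ^ 2) 0 1 := by
    refine Real.circleAverage_mono ?_ ?_ ?_
    · exact (((continuous_tsum_mul_circleMap_pow ha).norm).pow 2).intervalIntegrable _ _
    · exact ((((continuous_tsum_mul_circleMap_pow hg).norm).pow 2).const_smul
        (Real.exp x)).intervalIntegrable _ _
    · intro z hz
      have hz1 : ‖z‖ = 1 := by simpa using hz
      have ht : ‖(r : ℂ) * z‖ < 1 := by simpa [hz1] using hra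
      have h1 : ∑' n, g n * z ^ n = (1 - (r : ℂ) * z)⁻¹ := by
        rw [← tsum_geometric_of_norm_lt_one ht]
        refine tsum_congr fun n => ?_
        simp only [hg_def]
        push_cast
        ring
      have h2 : ∑' n, a n * z ^ n =
          (1 - (r : ℂ) * z)⁻¹ * Complex.exp ((r : ℂ) * z * (-(x : ℂ)) / (1 - (r : ℂ) * z)) := by
        rw [← (hasSum_laguerreNeg ht (-(x : ℂ))).tsum_eq]
        refine tsum_congr fun n => ?_
        rw [laguerreNeg_neg_ofReal]
        simp only [ha_def]
        push_cast
        ring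
      simp only [h1, h2, smul_eq_mul]
      exact norm_laguerre_generating_sq_le ht hx
  rw [Real.circleAverage_fun_smul, hgsum, smul_eq_mul, mul_one_div] at hmono
  have hs := hasSum_sq_norm_circleAverage ha
  refine le_trans ?_ ((hs.summable.sum_le_tsum (Finset.range N)
    fun n _ => by positivity).trans (hs.tsum_eq.le.trans hmono))
  refine le_of_eq (Finset.sum_congr rfl fun n _ => ?_)
  simp only [ha_def, Complex.norm_real, Real.norm_eq_abs, sq_abs]

/-- Split `uⁿ = √uⁿ · √uⁿ` and apply Cauchy–Schwarz: each square sum contributes a factor `1 / (1 -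
u)`, and together they cancel `(1 - u)²`. -/
theorem sum_pow_mul_abs_laguerreL_le {u : ℝ} (hu0 : 0 ≤ u) (hu : u < 1) {x : ℝ} (hx : 0 ≤ x)
    (N : ℕ) :
    ∑ n ∈ Finset.range N, u ^ n * (1 - u) * |laguerreL n x| ≤ Real.exp (x / 2) := by
  have h1u : 0 < 1 - u := by linarith
  have hsq : Real.sqrt u ^ 2 = u := Real.sq_sqrt hu0
  have hs1 : Real.sqrt u < 1 := by
    rw [Real.sqrt_lt' one_pos]
    simpa using hu
  have hCS := Finset.sum_mul_sq_le_sq_mul_sq (Finset.range N) (fun n => Real.sqrt u ^ n)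
    (fun n => Real.sqrt u ^ n * |laguerreL n x|)
  have hA : ∑ n ∈ Finset.range N, (Real.sqrt u ^ n) ^ 2 ≤ 1 / (1 - u) := by
    have := (summable_geometric_of_lt_one hu0 hu).sum_le_tsum (Finset.range N)
      fun n _ => by positivity
    rw [tsum_geometric_of_lt_one hu0 hu, ← one_div] at this
    refine le_trans (le_of_eq (Finset.sum_congr rfl fun n _ => ?_)) this
    rw [← pow_mul, mul_comm, pow_mul, hsq]
  have hB : ∑ n ∈ Finset.range N, (Real.sqrt u ^ n * |laguerreL n x|) ^ 2 ≤
      Real.exp x / (1 - u) := by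
    have := sum_pow_mul_laguerreL_sq_le (Real.sqrt_nonneg u) hs1 hx N
    rw [hsq] at this
    refine le_trans (le_of_eq (Finset.sum_congr rfl fun n _ => ?_)) this
    rw [mul_pow, mul_pow, sq_abs]
  have hS : ∑ n ∈ Finset.range N, u ^ n * (1 - u) * |laguerreL n x| =
      (1 - u) * ∑ n ∈ Finset.range N, Real.sqrt u ^ n * (Real.sqrt u ^ n * |laguerreL n x|) := by
    rw [Finset.mul_sum]
    refine Finset.sum_congr rfl fun n _ => ?_
    have : Real.sqrt u ^ n * Real.sqrt u ^ n = u ^ n := by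
      rw [← mul_pow, ← sq, hsq]
    rw [← this]
    ring
  rw [hS]
  refine abs_le_of_sq_le_sq' ?_ (Real.exp_pos _).le |>.2
  rw [mul_pow, ← Real.exp_nat_mul, show ((2 : ℕ) : ℝ) * (x / 2) = x by push_cast; ring]
  calc _ ≤ (1 - u) ^ 2 * (1 / (1 - u) * (Real.exp x / (1 - u))) := by
        gcongr
        refine hCS.trans ?_
        gcongr
    _ = Real.exp x := by field_simp

/-- At a nonpositive argument all terms of the generating series are nonnegative, so each is bounded
by the sum. -/
theorem pow_mul_laguerreL_neg_abs_le {t : ℝ} (ht0 : 0 ≤ t) (ht : t < 1) (n : ℕ) (x : ℝ) :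
    t ^ n * laguerreL n (-|x|) ≤ (1 - t)⁻¹ * Real.exp (t / (1 - t) * |x|) := by
  have h := hasSum_laguerreL (u := t) (by rwa [abs_of_nonneg ht0]) (-|x|)
  rw [neg_mul_neg] at h
  exact le_hasSum h n fun j _ =>
    mul_nonneg (pow_nonneg ht0 j) ((abs_nonneg _).trans (abs_laguerreL_le j x))

/-! ### Generating series of the Laguerre moments. -/

section Moments

variable {S : Type*} [MeasurableSpace S] {P : Measure S} {X : S → ℝ}

theorem integrable_exp_mul_of_le {a c : ℝ} [IsFiniteMeasure P] (hX : AEMeasurable X P)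
    (hX0 : ∀ᵐ s ∂P, 0 ≤ X s) (hc : Integrable (fun s => Real.exp (c * X s)) P) (hac : a ≤ c) :
    Integrable (fun s => Real.exp (a * X s)) P := by
  refine hc.mono' (by fun_prop) ?_
  filter_upwards [hX0] with s hs
  rw [Real.norm_of_nonneg (Real.exp_pos _).le]
  gcongr

theorem integrable_laguerreL_comp (hX : AEMeasurable X P)
    (hX0 : ∀ᵐ s ∂P, 0 ≤ X s) {δ : ℝ} (hδ : 0 < δ)
    (hexp : Integrable (fun s => Real.exp (δ * X s)) P) (n : ℕ) :
    Integrable (fun s => laguerreL n (X s)) P := by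
  -- Chosen so that `t / (1 - t) = δ`: the majorant at `t` is then controlled by the assumed moment.
  set t := δ / (1 + δ) with ht
  have ht0 : 0 < t := by positivity
  have ht1 : t < 1 := by rw [ht, div_lt_one (by positivity)]; linarith
  have htδ : t / (1 - t) = δ := by rw [ht]; field_simp; ring
  refine ((hexp.const_mul (1 - t)⁻¹).const_mul (t ^ n)⁻¹).mono'
    ((continuous_laguerreL n).comp_aestronglyMeasurable hX.aestronglyMeasurable) ?_
  filter_upwards [hX0] with s hs
  have h := pow_mul_laguerreL_neg_abs_le ht0.le ht1 n (X s)
  rw [htδ, abs_of_nonneg hs] at h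
  rw [Real.norm_eq_abs, le_inv_mul_iff₀ (by positivity)]
  refine le_trans ?_ h
  gcongr
  have := abs_laguerreL_le n (X s)
  rwa [abs_of_nonneg hs] at this

theorem hasSum_pow_mul_integral_laguerreL (hX : AEMeasurable X P)
    (hX0 : ∀ᵐ s ∂P, 0 ≤ X s) {δ : ℝ} (hδ : 0 < δ)
    (hexp : Integrable (fun s => Real.exp (δ * X s)) P) {u : ℝ} (hu : |u| ≤ δ / (1 + δ)) :
    HasSum (fun n => u ^ n * ∫ s, laguerreL n (X s) ∂P)
      ((1 - u)⁻¹ * mgf X P (-(u / (1 - u)))) := by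
  set t := δ / (1 + δ) with ht
  have ht0 : 0 < t := by positivity
  have ht1 : t < 1 := by rw [ht, div_lt_one (by positivity)]; linarith
  have htδ : t / (1 - t) = δ := by rw [ht]; field_simp; ring
  have hgen : ∀ x : ℝ, 0 ≤ x → HasSum (fun n => t ^ n * laguerreL n (-|x|))
      ((1 - t)⁻¹ * Real.exp (δ * x)) := by
    intro x hx
    have h := hasSum_laguerreL (u := t) (by rwa [abs_of_nonneg ht0.le]) (-|x|)
    rw [neg_mul_neg, htδ] at h
    simpa only [abs_of_nonneg hx] using h
  have h := hasSum_integral_of_dominated_convergence (μ := P)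
    (F := fun n s => u ^ n * laguerreL n (X s))
    (f := fun s => (1 - u)⁻¹ * Real.exp (-(u / (1 - u)) * X s))
    (fun n s => t ^ n * laguerreL n (-|X s|)) ?_ ?_ ?_ ?_ ?_
  · simpa only [integral_const_mul, mgf] using h
  · exact fun n => ((continuous_laguerreL n).comp_aestronglyMeasurable
      hX.aestronglyMeasurable).const_mul _
  · refine fun n => Eventually.of_forall fun s => ?_
    rw [norm_mul, norm_pow, Real.norm_eq_abs, Real.norm_eq_abs]
    gcongr
    exact abs_laguerreL_le n _
  · filter_upwards [hX0] with s hs using (hgen _ hs).summable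
  · refine (hexp.const_mul (1 - t)⁻¹).congr ?_
    filter_upwards [hX0] with s hs using (hgen _ hs).tsum_eq.symm
  · exact Eventually.of_forall fun s => hasSum_laguerreL (hu.trans_lt ht1) _

/-- The bound gives radius of convergence at least `1`. The sum and the moment generating function
expression are both analytic on `(-t, 1)` and agree near `0`, hence on the whole interval. -/
theorem hasSum_pow_mul_integral_laguerreL_of_bound [IsFiniteMeasure P] (hX : AEMeasurable X P)
    (hX0 : ∀ᵐ s ∂P, 0 ≤ X s) {δ : ℝ} (hδ : 0 < δ)
    (hexp : Integrable (fun s => Real.exp (δ * X s)) P)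
    (hbound : ∀ r : ℝ, 0 < r → r < 1 → ∃ K, ∀ n, |∫ s, laguerreL n (X s) ∂P| * r ^ n ≤ K)
    {u : ℝ} (hu0 : 0 ≤ u) (hu : u < 1) :
    HasSum (fun n => u ^ n * ∫ s, laguerreL n (X s) ∂P)
      ((1 - u)⁻¹ * mgf X P (-(u / (1 - u)))) := by
  set C : ℕ → ℝ := fun n => ∫ s, laguerreL n (X s) ∂P with hC
  set t := δ / (1 + δ) with ht
  have ht0 : 0 < t := by positivity
  have ht1 : t < 1 := by rw [ht, div_lt_one (by positivity)]; linarith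
  have htδ : t ≤ δ := by rw [ht, div_le_iff₀ (by positivity)]; nlinarith
  set p := FormalMultilinearSeries.ofScalars ℝ C with hp
  have hrad : 1 ≤ p.radius := by
    refine ENNReal.le_of_forall_nnreal_lt fun r hr => ?_
    have hr1 : (r : ℝ) < 1 := by exact_mod_cast hr
    rcases eq_or_ne r 0 with rfl | hr0
    · simp
    obtain ⟨K, hK⟩ := hbound r (by positivity) hr1
    refine p.le_radius_of_bound K fun n => ?_
    rw [hp, FormalMultilinearSeries.ofScalars_norm]
    exact hK n
  have hsumm : ∀ v : ℝ, |v| < 1 → HasSum (fun n => v ^ n * C n) (p.sum v) := by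
    intro v hv
    have := p.hasSum (x := v) (by
      rw [Metric.mem_eball, edist_zero_right]
      refine lt_of_lt_of_le ?_ hrad
      rw [← ofReal_norm, Real.norm_eq_abs]
      exact ENNReal.ofReal_lt_one.2 hv)
    simpa [hp, FormalMultilinearSeries.ofScalars_apply_eq, mul_comm] using this
  have hpan : AnalyticOnNhd ℝ p.sum (Set.Ioo (-t) 1) := by
    intro v hv
    have h1 := (p.hasFPowerSeriesOnBall (lt_of_lt_of_le one_pos hrad)).analyticOnNhd
    refine h1 v ?_
    rw [Metric.mem_eball, edist_zero_right]
    refine lt_of_lt_of_le ?_ hrad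
    rw [← ofReal_norm, Real.norm_eq_abs]
    exact ENNReal.ofReal_lt_one.2 (abs_lt.2 ⟨by linarith [hv.1], hv.2⟩)
  have hint : Set.Iio δ ⊆ interior (integrableExpSet X P) := by
    refine interior_maximal (fun a ha => ?_) isOpen_Iio
    exact integrable_exp_mul_of_le hX hX0 hexp (le_of_lt ha)
  have hman : AnalyticOnNhd ℝ (fun v => (1 - v)⁻¹ * mgf X P (-(v / (1 - v))))
      (Set.Ioo (-t) 1) := by
    intro v hv
    have hv1 : (1 - v) ≠ 0 := by linarith [hv.2]
    have h1 : AnalyticAt ℝ (fun v : ℝ => 1 - v) v := analyticAt_const.sub analyticAt_id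
    refine (h1.inv hv1).mul ?_
    have h2 : AnalyticAt ℝ (fun v : ℝ => -(v / (1 - v))) v := (analyticAt_id.div h1 hv1).neg
    refine AnalyticAt.fun_comp (f := fun v : ℝ => -(v / (1 - v))) (g := mgf X P)
      (analyticAt_mgf (hint ?_)) h2
    have hpos : 0 < 1 - v := by linarith [hv.2]
    rw [Set.mem_Iio, ← neg_div, div_lt_iff₀ hpos]
    rcases le_or_gt 0 v with h | h
    · nlinarith [mul_pos hδ hpos]
    · nlinarith [hv.1, mul_pos hδ (neg_pos.2 h)]
  have heq := hpan.eqOn_of_preconnected_of_eventuallyEq hman isPreconnected_Ioo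
    (z₀ := 0) ⟨by linarith, one_pos⟩ (by
      have hnh : Set.Ioo (-t) t ∈ 𝓝 (0 : ℝ) := Ioo_mem_nhds (by linarith) ht0
      filter_upwards [hnh] with v hv
      have hvt : |v| ≤ t := abs_le.2 ⟨hv.1.le, hv.2.le⟩
      exact (hsumm v (hvt.trans_lt ht1)).unique
        (hasSum_pow_mul_integral_laguerreL hX hX0 hδ hexp hvt))
  have := hsumm u (by rwa [abs_of_nonneg hu0])
  rwa [heq (⟨by linarith, hu⟩ : u ∈ Set.Ioo (-t) 1)] at this

end Moments

/-! ### Integration of the generating series against a mixing measure. -/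

section Mixture

variable {S T : Type*} [MeasurableSpace S] [MeasurableSpace T] {P : Measure S} {ν : Measure T}
  {X : S → ℝ} {u : T → ℝ}

theorem integrable_exp_neg_mul_prod [IsFiniteMeasure P] [IsFiniteMeasure ν]
    (hX : AEMeasurable X P) (hX0 : ∀ᵐ s ∂P, 0 ≤ X s) {l : T → ℝ} (hl : Measurable l)
    (hl0 : ∀ t, 0 ≤ l t) :
    Integrable (fun z : S × T => Real.exp (-(l z.2) * X z.1)) (P.prod ν) := by
  have hX' : AEMeasurable (fun z : S × T => X z.1) (P.prod ν) := hX.comp_fst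
  have hX0' : ∀ᵐ z ∂(P.prod ν), 0 ≤ X z.1 := Measure.quasiMeasurePreserving_fst.ae hX0
  have hl' : Measurable fun z : S × T => l z.2 := hl.comp measurable_snd
  refine Integrable.mono' (integrable_const (1 : ℝ)) ?_ ?_
  · exact (Real.measurable_exp.comp_aemeasurable
      (hl'.neg.aemeasurable.mul hX')).aestronglyMeasurable
  · filter_upwards [hX0'] with z hz
    rw [Real.norm_of_nonneg (Real.exp_pos _).le, Real.exp_le_one_iff]
    nlinarith [mul_nonneg (hl0 z.2) hz]

theorem integrable_pow_mul_one_sub [IsFiniteMeasure ν] (hu : Measurable u) (hu0 : ∀ t, 0 ≤ u t)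
    (hu1 : ∀ t, u t < 1) (n : ℕ) : Integrable (fun t => u t ^ n * (1 - u t)) ν := by
  refine Integrable.mono' (integrable_const (1 : ℝ)) (by fun_prop) (Eventually.of_forall ?_)
  intro t
  have h1 : 0 ≤ 1 - u t := by linarith [hu1 t]
  have h2 := pow_le_one₀ (n := n) (hu0 t) (hu1 t).le
  rw [Real.norm_of_nonneg (mul_nonneg (pow_nonneg (hu0 t) n) h1)]
  exact mul_le_one₀ h2 h1 (by linarith [hu0 t])

/-- Only the part of the integral over `{r ≤ u}` is kept; there `uⁿ ≥ rⁿ`, and `1 - u > 0` has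
positive integral. -/
theorem exists_pos_mul_pow_le_integral [IsFiniteMeasure ν] (hu : Measurable u)
    (hu0 : ∀ t, 0 ≤ u t) (hu1 : ∀ t, u t < 1) {r : ℝ} (hr : 0 ≤ r) (hν : ν {t | r ≤ u t} ≠ 0) :
    ∃ c, 0 < c ∧ ∀ n : ℕ, c * r ^ n ≤ ∫ t, u t ^ n * (1 - u t) ∂ν := by
  set A := {t | r ≤ u t} with hA_def
  have hA : MeasurableSet A := measurableSet_le measurable_const hu
  have hint := integrable_pow_mul_one_sub (ν := ν) hu hu0 hu1
  have hint0 : Integrable (fun t => 1 - u t) ν := by simpa using hint 0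
  refine ⟨∫ t in A, (1 - u t) ∂ν, ?_, fun n => ?_⟩
  · rw [setIntegral_pos_iff_support_of_nonneg_ae
      (Eventually.of_forall fun t => by simpa using (hu1 t).le) hint0.integrableOn]
    have : Function.support (fun t => 1 - u t) = Set.univ :=
      Set.eq_univ_of_forall fun t => by
        rw [Function.mem_support]
        linarith [hu1 t]
    rw [this, Set.univ_inter]
    exact pos_iff_ne_zero.2 hν
  · calc (∫ t in A, (1 - u t) ∂ν) * r ^ n = ∫ t in A, r ^ n * (1 - u t) ∂ν := by
          rw [integral_const_mul, mul_comm]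
      _ ≤ ∫ t in A, u t ^ n * (1 - u t) ∂ν := by
          refine setIntegral_mono_on (hint0.const_mul _).integrableOn (hint n).integrableOn hA ?_
          intro t ht
          have h1 : 0 ≤ 1 - u t := by linarith [hu1 t]
          have h2 : r ≤ u t := ht
          gcongr
      _ ≤ ∫ t, u t ^ n * (1 - u t) ∂ν := by
          refine setIntegral_le_integral (hint n) (Eventually.of_forall fun t => ?_)
          exact mul_nonneg (pow_nonneg (hu0 t) n) (by linarith [hu1 t])

theorem summable_integral_laguerreL_mul [IsFiniteMeasure P] [IsFiniteMeasure ν]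
    (hX : AEMeasurable X P) (hX0 : ∀ᵐ s ∂P, 0 ≤ X s)
    (hexp : Integrable (fun s => Real.exp (1 / 2 * X s)) P)
    (hu : Measurable u) (hu0 : ∀ t, 0 ≤ u t) (hu1 : ∀ t, u t < 1) :
    Summable fun n : ℕ => (∫ s, laguerreL n (X s) ∂P) * ∫ t, u t ^ n * (1 - u t) ∂ν := by
  have hint := integrable_pow_mul_one_sub (ν := ν) hu hu0 hu1
  have hL := integrable_laguerreL_comp hX hX0 (by norm_num) hexp
  have hD0 : ∀ n : ℕ, 0 ≤ ∫ t, u t ^ n * (1 - u t) ∂ν := fun n =>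
    integral_nonneg fun t => mul_nonneg (pow_nonneg (hu0 t) n) (by linarith [hu1 t])
  refine Summable.of_norm (summable_of_sum_range_le
    (c := ∫ _, (∫ s, Real.exp (1 / 2 * X s) ∂P) ∂ν) (fun n => norm_nonneg _) fun N => ?_)
  have h1 : ∀ n : ℕ, ‖(∫ s, laguerreL n (X s) ∂P) * ∫ t, u t ^ n * (1 - u t) ∂ν‖ =
      ∫ t, u t ^ n * (1 - u t) * |∫ s, laguerreL n (X s) ∂P| ∂ν := fun n => by
    rw [integral_mul_const, norm_mul, Real.norm_of_nonneg (hD0 n), Real.norm_eq_abs, mul_comm]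
  simp_rw [h1]
  rw [← integral_finsetSum _ fun n _ => (hint n).mul_const _]
  refine integral_mono (integrable_finsetSum _ fun n _ => (hint n).mul_const _)
    (integrable_const _) fun t => ?_
  have h0 : ∀ n : ℕ, 0 ≤ u t ^ n * (1 - u t) := fun n =>
    mul_nonneg (pow_nonneg (hu0 t) n) (by linarith [hu1 t])
  calc ∑ n ∈ Finset.range N, u t ^ n * (1 - u t) * |∫ s, laguerreL n (X s) ∂P|
      ≤ ∑ n ∈ Finset.range N, ∫ s, u t ^ n * (1 - u t) * |laguerreL n (X s)| ∂P := by
        refine Finset.sum_le_sum fun n _ => ?_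
        rw [integral_const_mul]
        exact mul_le_mul_of_nonneg_left abs_integral_le_integral_abs (h0 n)
    _ = ∫ s, ∑ n ∈ Finset.range N, u t ^ n * (1 - u t) * |laguerreL n (X s)| ∂P :=
        (integral_finsetSum _ fun n _ => (hL n).abs.const_mul _).symm
    _ ≤ ∫ s, Real.exp (1 / 2 * X s) ∂P := by
        refine integral_mono_ae (integrable_finsetSum _ fun n _ => (hL n).abs.const_mul _)
          hexp ?_
        filter_upwards [hX0] with s hs
        have := sum_pow_mul_abs_laguerreL_le (hu0 t) (hu1 t) hs N
        rwa [show 1 / 2 * X s = X s / 2 by ring]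

theorem integral_integral_exp_eq_of_tendsto [IsProbabilityMeasure P] [IsFiniteMeasure ν]
    (hX : AEMeasurable X P) (hX0 : ∀ᵐ s ∂P, 0 ≤ X s) {δ : ℝ} (hδ : 0 < δ)
    (hexp : Integrable (fun s => Real.exp (δ * X s)) P)
    (hu : Measurable u) (hu0 : ∀ t, 0 ≤ u t) (hu1 : ∀ t, u t < 1)
    (hν : ∀ r < 1, ν {t | r ≤ u t} ≠ 0) {σ : ℝ}
    (hσ : Tendsto (fun N : ℕ => ∑ n ∈ Finset.range N,
      (∫ s, laguerreL n (X s) ∂P) * ∫ t, u t ^ n * (1 - u t) ∂ν) atTop (𝓝 σ)) :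
    ∫ s, ∫ t, Real.exp (-(u t / (1 - u t)) * X s) ∂ν ∂P = σ := by
  set C : ℕ → ℝ := fun n => ∫ s, laguerreL n (X s) ∂P with hC
  set D : ℕ → ℝ := fun n => ∫ t, u t ^ n * (1 - u t) ∂ν with hD
  have hint := integrable_pow_mul_one_sub (ν := ν) hu hu0 hu1
  -- Terms of a convergent series tend to zero; with the lower bound on `D`, this forces `C n =
  -- O(r⁻ⁿ)` for every `0 < r < 1`.
  have hterm : Tendsto (fun n => C n * D n) atTop (𝓝 0) := by
    have h := (hσ.comp (tendsto_add_atTop_nat 1)).sub hσ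
    rw [sub_self] at h
    refine h.congr fun n => ?_
    simp [Finset.sum_range_succ, hC, hD]
  have hbound : ∀ r : ℝ, 0 < r → r < 1 → ∃ K, ∀ n, |C n| * r ^ n ≤ K := by
    intro r hr0 hr1
    obtain ⟨c, hc, hcD⟩ := exists_pos_mul_pow_le_integral hu hu0 hu1 hr0.le (hν r hr1)
    obtain ⟨K, hK⟩ := hterm.norm.bddAbove_range
    refine ⟨K / c, fun n => ?_⟩
    rw [le_div_iff₀ hc]
    have h1 : ‖C n * D n‖ ≤ K := hK ⟨n, rfl⟩
    have h2 : c * r ^ n ≤ |D n| := (hcD n).trans (le_abs_self _)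
    rw [Real.norm_eq_abs, abs_mul] at h1
    calc |C n| * r ^ n * c = |C n| * (c * r ^ n) := by ring
      _ ≤ |C n| * |D n| := by gcongr
      _ ≤ K := h1
  have hgen : ∀ v : ℝ, 0 ≤ v → v < 1 → HasSum (fun n => v ^ n * C n)
      ((1 - v)⁻¹ * mgf X P (-(v / (1 - v)))) := fun v hv0 hv1 =>
    hasSum_pow_mul_integral_laguerreL_of_bound hX hX0 hδ hexp hbound hv0 hv1
  have hmgf1 : ∀ v : ℝ, 0 ≤ v → v < 1 → mgf X P (-(v / (1 - v))) ≤ 1 := by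
    intro v hv0 hv1
    have hl : 0 ≤ v / (1 - v) := div_nonneg hv0 (by linarith)
    calc mgf X P (-(v / (1 - v))) ≤ ∫ _, (1 : ℝ) ∂P := by
          refine integral_mono_ae
            (integrable_exp_mul_of_le hX hX0 hexp (by linarith)) (integrable_const _) ?_
          filter_upwards [hX0] with s hs
          rw [Real.exp_le_one_iff]
          nlinarith [mul_nonneg hl hs]
      _ = 1 := by simp
  -- The Abel regularisation: inserting `xⁿ` replaces `u t` by `x * u t` in the generating function
  -- but leaves the factor `1 - u t` alone.
  set G : ℝ → T → ℝ := fun x t =>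
    (1 - x * u t)⁻¹ * mgf X P (-(x * u t / (1 - x * u t))) * (1 - u t) with hG
  have hxu : ∀ x : ℝ, 0 < x → x < 1 → ∀ t, 0 ≤ x * u t ∧ x * u t < 1 ∧ x * u t ≤ u t := by
    intro x hx0 hx1 t
    have h1 := hu0 t
    have h2 := hu1 t
    exact ⟨by positivity, by nlinarith, by nlinarith⟩
  have hAbel : ∀ x : ℝ, 0 < x → x < 1 → AEStronglyMeasurable (G x) ν ∧
      ∑' n, C n * D n * x ^ n = ∫ t, G x t ∂ν := by
    intro x hx0 hx1
    have hsum : ∀ t, HasSum (fun n => x ^ n * C n * (u t ^ n * (1 - u t))) (G x t) := by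
      intro t
      have h := (hgen (x * u t) (hxu x hx0 hx1 t).1 (hxu x hx0 hx1 t).2.1).mul_right (1 - u t)
      convert! h using 2 with n
      rw [mul_pow]
      ring
    have habs : Summable fun n => x ^ n * |C n| := by
      refine ((hgen x hx0.le hx1).summable.abs).congr fun n => ?_
      rw [abs_mul, abs_of_nonneg (by positivity : (0 : ℝ) ≤ x ^ n)]
    have hmeas : ∀ n, AEStronglyMeasurable (fun t => x ^ n * C n * (u t ^ n * (1 - u t))) ν :=
      fun n => (hint n).aestronglyMeasurable.const_mul _
    refine ⟨aestronglyMeasurable_of_tendsto_ae atTop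
      (f := fun (N : ℕ) t => ∑ n ∈ Finset.range N, x ^ n * C n * (u t ^ n * (1 - u t)))
      (fun N => Finset.aestronglyMeasurable_fun_sum _ fun n _ => hmeas n)
      (Eventually.of_forall fun t => (hsum t).tendsto_sum_nat), ?_⟩
    have h := hasSum_integral_of_dominated_convergence (μ := ν)
      (F := fun n t => x ^ n * C n * (u t ^ n * (1 - u t))) (f := G x)
      (fun n _ => x ^ n * |C n|) hmeas ?_ (Eventually.of_forall fun _ => habs)
      (integrable_const _) (Eventually.of_forall hsum)
    · rw [← h.tsum_eq]
      refine tsum_congr fun n => ?_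
      rw [integral_const_mul]
      simp only [hD]
      ring
    · refine fun n => Eventually.of_forall fun t => ?_
      have h1 : 0 ≤ 1 - u t := by linarith [hu1 t]
      have h2 : u t ^ n * (1 - u t) ≤ 1 :=
        mul_le_one₀ (pow_le_one₀ (hu0 t) (hu1 t).le) h1 (by linarith [hu0 t])
      have h3 : 0 ≤ u t ^ n * (1 - u t) := mul_nonneg (pow_nonneg (hu0 t) n) h1
      rw [norm_mul, norm_mul, Real.norm_of_nonneg h3, Real.norm_eq_abs, Real.norm_eq_abs,
        abs_of_nonneg (by positivity : (0 : ℝ) ≤ x ^ n)]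
      exact mul_le_of_le_one_right (by positivity) h2
  have hnhds : ∀ᶠ x : ℝ in 𝓝[<] 1, 0 < x ∧ x < 1 := by
    filter_upwards [Ioo_mem_nhdsLT (zero_lt_one' ℝ)] with x hx using hx
  have hlim : Tendsto (fun x => ∫ t, G x t ∂ν) (𝓝[<] 1)
      (𝓝 (∫ t, mgf X P (-(u t / (1 - u t))) ∂ν)) := by
    refine tendsto_integral_filter_of_dominated_convergence (fun _ => (1 : ℝ)) ?_ ?_
      (integrable_const _) ?_
    · filter_upwards [hnhds] with x hx using (hAbel x hx.1 hx.2).1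
    · filter_upwards [hnhds] with x hx
      refine Eventually.of_forall fun t => ?_
      obtain ⟨h1, h2, h3⟩ := hxu x hx.1 hx.2 t
      have h4 : 0 ≤ 1 - u t := by linarith [hu1 t]
      have h5 : 0 < 1 - x * u t := by linarith
      have h6 := hmgf1 _ h1 h2
      have h7 : 0 ≤ mgf X P (-(x * u t / (1 - x * u t))) := mgf_nonneg
      rw [Real.norm_of_nonneg (by positivity)]
      -- The dominating constant is `1`: the transform is at most `1` at nonpositive arguments, and
      -- `1 - u t ≤ 1 - x * u t`.
      calc G x t = mgf X P (-(x * u t / (1 - x * u t))) * ((1 - u t) / (1 - x * u t)) := by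
            simp only [hG]
            ring
        _ ≤ 1 := mul_le_one₀ h6 (by positivity) (by rw [div_le_one h5]; linarith)
    · refine Eventually.of_forall fun t => ?_
      have h1 : 1 - u t ≠ 0 := by linarith [hu1 t]
      have hpos : 0 < 1 - u t := by linarith [hu1 t]
      have hx : ContinuousAt (fun x : ℝ => x * u t) 1 := by fun_prop
      have hx1 : ContinuousAt (fun x : ℝ => 1 - x * u t) 1 := by fun_prop
      have hq : ContinuousAt (fun x : ℝ => -(x * u t / (1 - x * u t))) 1 :=
        (hx.div hx1 (by simpa using h1)).neg
      have hm : ContinuousAt (mgf X P) (-(1 * u t / (1 - 1 * u t))) := by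
        refine (analyticAt_mgf ?_).continuousAt
        refine interior_maximal (t := Set.Iio δ) (fun a ha => ?_) isOpen_Iio ?_
        · exact integrable_exp_mul_of_le hX hX0 hexp (le_of_lt ha)
        · rw [one_mul, Set.mem_Iio]
          have := div_nonneg (hu0 t) hpos.le
          linarith
      have hG1 : ContinuousAt (fun x => G x t) 1 :=
        ((hx1.inv₀ (by simpa using h1)).mul
          (ContinuousAt.comp (f := fun x : ℝ => -(x * u t / (1 - x * u t))) hm hq)).mul
          continuousAt_const
      have hval : G 1 t = mgf X P (-(u t / (1 - u t))) := by
        simp only [hG, one_mul]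
        field_simp
      rw [← hval]
      exact hG1.tendsto.mono_left nhdsWithin_le_nhds
  have hfin : ∫ t, mgf X P (-(u t / (1 - u t))) ∂ν = σ := by
    refine tendsto_nhds_unique hlim ?_
    refine (Real.tendsto_tsum_powerSeries_nhdsWithin_lt hσ).congr' ?_
    filter_upwards [hnhds] with x hx using (hAbel x hx.1 hx.2).2
  rw [← hfin, integral_integral_swap]
  · rfl
  · exact integrable_exp_neg_mul_prod hX hX0 (l := fun t => u t / (1 - u t)) (by fun_prop)
      fun t => div_nonneg (hu0 t) (by linarith [hu1 t])

end Mixture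

/-! ### Craig's representation of the Gauss Q-function. -/

/-- Half the standard Cauchy law: the mixing measure of Craig's representation of the Gauss
Q-function as a mixture of Gaussian functions. -/
def craigMeasure : Measure ℝ :=
  volume.withDensity fun s => ENNReal.ofReal ((2 * Real.pi)⁻¹ * (1 + s ^ 2)⁻¹)

instance : IsFiniteMeasure craigMeasure :=
  isFiniteMeasure_withDensity_ofReal (integrable_inv_one_add_sq.const_mul _).2

theorem integral_craigMeasure (f : ℝ → ℝ) :
    ∫ s, f s ∂craigMeasure = ∫ s, (2 * Real.pi)⁻¹ * (1 + s ^ 2)⁻¹ * f s := by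
  rw [craigMeasure, integral_withDensity_eq_integral_toReal_smul (by fun_prop)
    (Eventually.of_forall fun _ => ENNReal.ofReal_lt_top)]
  refine integral_congr_ae (Eventually.of_forall fun s => ?_)
  simp only [smul_eq_mul]
  rw [ENNReal.toReal_ofReal (by positivity)]

theorem volume_absolutelyContinuous_craigMeasure : volume ≪ craigMeasure := by
  refine withDensity_absolutelyContinuous' (by fun_prop) (Eventually.of_forall fun s => ?_)
  rw [Ne, ENNReal.ofReal_eq_zero, not_le]
  positivity

/-- Up to the factor `√(2π)`, `exp (-t² / 2)` is the Gaussian integral over `s` of `F t s`. After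
Fubini, the factor `t` makes the integral over `t > z` elementary. -/
theorem gaussQ_eq_integral_craigMeasure {z : ℝ} (hz : 0 ≤ z) :
    gaussQ z = ∫ s, Real.exp (-(z ^ 2 / 2 * (1 + s ^ 2))) ∂craigMeasure := by
  set F : ℝ → ℝ → ℝ := fun t s => t * Real.exp (-t ^ 2 / 2) * Real.exp (-(t ^ 2 / 2) * s ^ 2)
    with hF
  have hF2 : ∀ t s, F t s = t * Real.exp (-((1 + s ^ 2) / 2) * t ^ 2) := fun t s => by
    simp only [hF]
    rw [mul_assoc, ← Real.exp_add]
    ring_nf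
  have hrow : ∀ t ∈ Set.Ioi z, ∫ s, F t s = Real.sqrt (2 * Real.pi) * Real.exp (-t ^ 2 / 2) := by
    intro t ht
    have ht0 : 0 < t := lt_of_le_of_lt hz ht
    simp only [hF]
    rw [integral_const_mul, integral_gaussian,
      show Real.pi / (t ^ 2 / 2) = 2 * Real.pi / t ^ 2 by field_simp,
      Real.sqrt_div (by positivity), Real.sqrt_sq ht0.le]
    field_simp
  have hgauss : Integrable fun t : ℝ => Real.exp (-t ^ 2 / 2) := by
    refine (integrable_exp_neg_mul_sq (b := 1 / 2) (by norm_num)).congr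
      (Eventually.of_forall fun t => ?_)
    simp only
    congr 1
    ring
  have hint : Integrable (Function.uncurry F) ((volume.restrict (Set.Ioi z)).prod volume) := by
    rw [integrable_prod_iff (by
      have : Continuous (Function.uncurry F) := by
        simp only [hF, Function.uncurry_def]
        fun_prop
      exact this.aestronglyMeasurable)]
    refine ⟨?_, ?_⟩
    · filter_upwards [ae_restrict_mem measurableSet_Ioi] with t ht
      have ht0 : 0 < t := lt_of_le_of_lt hz ht
      exact (integrable_exp_neg_mul_sq (b := t ^ 2 / 2) (by positivity)).const_mul
        (t * Real.exp (-t ^ 2 / 2))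
    · refine (hgauss.const_mul (Real.sqrt (2 * Real.pi))).integrableOn.congr ?_
      filter_upwards [ae_restrict_mem measurableSet_Ioi] with t ht
      have ht0 : 0 < t := lt_of_le_of_lt hz ht
      rw [← hrow t ht]
      refine integral_congr_ae (Eventually.of_forall fun s => ?_)
      have : 0 ≤ F t s := by simp only [hF]; positivity
      simp [Function.uncurry, abs_of_nonneg this]
  have hcol : ∀ s : ℝ, ∫ t in Set.Ioi z, F t s =
      (1 + s ^ 2)⁻¹ * Real.exp (-(z ^ 2 / 2 * (1 + s ^ 2))) := by
    intro s
    simp_rw [hF2]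
    have hc : 0 < (1 + s ^ 2) / 2 := by positivity
    have hd : ∀ t ∈ Set.Ici z, HasDerivAt
        (fun t : ℝ => -((1 + s ^ 2)⁻¹ * Real.exp (-((1 + s ^ 2) / 2) * t ^ 2)))
        (t * Real.exp (-((1 + s ^ 2) / 2) * t ^ 2)) t := by
      intro t _
      have h := ((((hasDerivAt_pow 2 t).const_mul (-((1 + s ^ 2) / 2))).exp).const_mul
        ((1 + s ^ 2)⁻¹)).neg
      refine h.congr_deriv ?_
      have : (1 + s ^ 2) ≠ 0 := by positivity
      field_simp
      ring
    have hlim : Tendsto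
        (fun t : ℝ => -((1 + s ^ 2)⁻¹ * Real.exp (-((1 + s ^ 2) / 2) * t ^ 2))) atTop (𝓝 0) := by
      have h1 : Tendsto (fun t : ℝ => -((1 + s ^ 2) / 2) * t ^ 2) atTop atBot :=
        (tendsto_pow_atTop two_ne_zero).const_mul_atTop_of_neg (by linarith)
      have h2 := ((Real.tendsto_exp_atBot.comp h1).const_mul ((1 + s ^ 2)⁻¹)).neg
      simpa using h2
    rw [integral_Ioi_of_hasDerivAt_of_nonneg' hd (fun t ht => ?_) hlim]
    · rw [zero_sub, neg_neg]
      congr 2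
      ring
    · have ht0 : 0 < t := lt_of_le_of_lt hz ht
      positivity
  have hswap := integral_integral_swap hint
  rw [setIntegral_congr_fun measurableSet_Ioi hrow, integral_const_mul] at hswap
  simp_rw [hcol] at hswap
  have hs : Real.sqrt (2 * Real.pi) ^ 2 = 2 * Real.pi := Real.sq_sqrt (by positivity)
  have hs0 : 0 < Real.sqrt (2 * Real.pi) := by positivity
  rw [gaussQ, integral_craigMeasure]
  simp_rw [mul_assoc (2 * Real.pi)⁻¹]
  rw [integral_const_mul, ← hswap,
    show (2 * Real.pi)⁻¹ = (Real.sqrt (2 * Real.pi) ^ 2)⁻¹ by rw [hs], ← mul_assoc]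
  congr 1
  generalize Real.sqrt (2 * Real.pi) = w at hs0
  field_simp

/-! ### Integrals of powers of `(A + c s²)⁻¹`. -/

theorem integrable_inv_add_mul_sq_pow {A c : ℝ} (hA : 0 < A) (hc : 0 < c) (p : ℕ) :
    Integrable fun s : ℝ => ((A + c * s ^ 2)⁻¹) ^ (p + 1) := by
  have hpos : ∀ s : ℝ, 0 < A + c * s ^ 2 := fun s => by positivity
  set d := min A c with hd
  have hd0 : 0 < d := lt_min hA hc
  have hle : ∀ s : ℝ, (A + c * s ^ 2)⁻¹ ≤ d⁻¹ * (1 + s ^ 2)⁻¹ := fun s => by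
    rw [← mul_inv]
    refine inv_anti₀ (by positivity) ?_
    nlinarith [min_le_left A c, min_le_right A c, sq_nonneg s]
  have hle' : ∀ s : ℝ, (A + c * s ^ 2)⁻¹ ≤ A⁻¹ := fun s =>
    inv_anti₀ hA (by nlinarith [mul_nonneg hc.le (sq_nonneg s)])
  refine (integrable_inv_one_add_sq.const_mul (A⁻¹ ^ p * d⁻¹)).mono' ?_
    (Eventually.of_forall fun s => ?_)
  · exact Continuous.aestronglyMeasurable
      (((by fun_prop : Continuous fun s : ℝ => A + c * s ^ 2).inv₀ fun s => (hpos s).ne').pow _)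
  · have h0 := inv_nonneg.2 (hpos s).le
    rw [Real.norm_of_nonneg (by positivity), pow_succ, mul_assoc]
    exact mul_le_mul (pow_le_pow_left₀ h0 (hle' s) p) (hle s) h0 (by positivity)

/-- The derivative of `s (A + c s²)⁻⁽ᵖ⁺¹⁾` integrates to zero over the line. -/
theorem integral_inv_add_mul_sq_pow_succ {A c : ℝ} (hA : 0 < A) (hc : 0 < c) (p : ℕ) :
    ∫ s : ℝ, ((A + c * s ^ 2)⁻¹) ^ (p + 2) =
      ((p : ℝ) + 1 / 2) / (((p : ℝ) + 1) * A) * ∫ s : ℝ, ((A + c * s ^ 2)⁻¹) ^ (p + 1) := by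
  have hpos : ∀ s : ℝ, 0 < A + c * s ^ 2 := fun s => by positivity
  have hi1 := integrable_inv_add_mul_sq_pow hA hc p
  have hi2 := integrable_inv_add_mul_sq_pow hA hc (p + 1)
  have hderiv : ∀ s : ℝ, HasDerivAt (fun s : ℝ => s * ((A + c * s ^ 2)⁻¹) ^ (p + 1))
      (2 * ((p : ℝ) + 1) * A * ((A + c * s ^ 2)⁻¹) ^ (p + 2) -
        (2 * (p : ℝ) + 1) * ((A + c * s ^ 2)⁻¹) ^ (p + 1)) s := by
    intro s
    have h1 : HasDerivAt (fun s : ℝ => A + c * s ^ 2) (c * (2 * s)) s := by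
      simpa using ((hasDerivAt_pow 2 s).const_mul c).const_add A
    have h2 := (hasDerivAt_id s).mul ((h1.inv (hpos s).ne').pow (p + 1))
    refine h2.congr_deriv ?_
    have := (hpos s).ne'
    simp only [id, Pi.inv_apply, Pi.pow_apply, Nat.add_sub_cancel]
    push_cast
    rw [pow_succ _ (p + 1), pow_succ _ p]
    field_simp
    ring
  have hlim : ∀ l : Filter ℝ, Tendsto (fun s : ℝ => |s|) l atTop →
      Tendsto (fun s : ℝ => s * ((A + c * s ^ 2)⁻¹) ^ (p + 1)) l (𝓝 0) := by
    intro l hl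
    have h0 : Tendsto (fun s : ℝ => A⁻¹ ^ p * c⁻¹ * |s|⁻¹) l (𝓝 0) := by
      simpa using (tendsto_inv_atTop_zero.comp hl).const_mul (A⁻¹ ^ p * c⁻¹)
    refine squeeze_zero_norm' ?_ h0
    filter_upwards [hl.eventually_gt_atTop 0] with s hs
    have hi := inv_nonneg.2 (hpos s).le
    have ha : (A + c * s ^ 2)⁻¹ ≤ A⁻¹ :=
      inv_anti₀ hA (by nlinarith [mul_nonneg hc.le (sq_nonneg s)])
    have hb : (A + c * s ^ 2)⁻¹ ≤ c⁻¹ * (|s| ^ 2)⁻¹ := by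
      rw [← mul_inv]
      refine inv_anti₀ (by positivity) ?_
      rw [sq_abs]
      linarith
    rw [norm_mul, Real.norm_eq_abs, Real.norm_of_nonneg (by positivity), pow_succ]
    calc |s| * ((A + c * s ^ 2)⁻¹ ^ p * (A + c * s ^ 2)⁻¹)
        ≤ |s| * (A⁻¹ ^ p * (c⁻¹ * (|s| ^ 2)⁻¹)) := by gcongr
      _ = A⁻¹ ^ p * c⁻¹ * |s|⁻¹ := by field_simp
  have h := integral_of_hasDerivAt_of_tendsto hderiv
    ((hi2.const_mul _).sub (hi1.const_mul _)) (hlim _ tendsto_abs_atBot_atTop)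
    (hlim _ tendsto_abs_atTop_atTop)
  rw [integral_sub (hi2.const_mul _) (hi1.const_mul _), integral_const_mul, integral_const_mul,
    sub_zero] at h
  have hp : (0 : ℝ) < p + 1 := by positivity
  rw [div_mul_eq_mul_div, eq_div_iff (by positivity)]
  linarith

theorem integral_inv_add_mul_sq_pow {A c : ℝ} (hA : 0 < A) (hc : 0 < c) (p : ℕ) :
    ∫ s : ℝ, ((A + c * s ^ 2)⁻¹) ^ (p + 1) =
      Real.sqrt (Real.pi / c) * (Real.Gamma ((p : ℝ) + 1 / 2) / Real.Gamma ((p : ℝ) + 1)) /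
        A ^ ((p : ℝ) + 1 / 2) := by
  induction p with
  | zero =>
    have hsA : Real.sqrt A ^ 2 = A := Real.sq_sqrt hA.le
    have hsc : Real.sqrt c ^ 2 = c := Real.sq_sqrt hc.le
    have hsA0 : 0 < Real.sqrt A := by positivity
    have hsc0 : 0 < Real.sqrt c := by positivity
    have h1 : ∀ s : ℝ, ((A + c * s ^ 2)⁻¹) ^ (0 + 1) =
        A⁻¹ * (1 + (Real.sqrt c / Real.sqrt A * s) ^ 2)⁻¹ := fun s => by
      rw [zero_add, pow_one, ← mul_inv, mul_pow, div_pow, hsA, hsc]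
      congr 1
      field_simp
    simp_rw [h1]
    rw [integral_const_mul,
      Measure.integral_comp_mul_left (fun s : ℝ => (1 + s ^ 2)⁻¹) (Real.sqrt c / Real.sqrt A),
      integral_univ_inv_one_add_sq, abs_of_pos (by positivity), Real.sqrt_div Real.pi_pos.le,
      smul_eq_mul, Nat.cast_zero, zero_add, zero_add, Real.Gamma_one_half_eq, Real.Gamma_one,
      ← Real.sqrt_eq_rpow]
    have hp : Real.sqrt Real.pi ^ 2 = Real.pi := Real.sq_sqrt Real.pi_pos.le
    field_simp
    rw [hsA, hp]
  | succ p ih =>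
    rw [show p + 1 + 1 = p + 2 by ring, integral_inv_add_mul_sq_pow_succ hA hc, ih]
    push_cast
    rw [show (p : ℝ) + 1 + 1 / 2 = ((p : ℝ) + 1 / 2) + 1 by ring,
      Real.Gamma_add_one (by positivity : (p : ℝ) + 1 / 2 ≠ 0),
      Real.Gamma_add_one (by positivity : (p : ℝ) + 1 ≠ 0), Real.rpow_add_one hA.ne']
    have h1 : 0 < A ^ ((p : ℝ) + 1 / 2) := by positivity
    have h2 : Real.Gamma ((p : ℝ) + 1) ≠ 0 := (Real.Gamma_pos_of_pos (by positivity)).ne'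
    field_simp

/-! ### The hypergeometric inner sum as an integral. -/

theorem Gamma_add_nat_eq_ascPochhammer {x : ℝ} (hx : 0 < x) (n : ℕ) :
    Real.Gamma (x + n) = (ascPochhammer ℝ n).eval x * Real.Gamma x := by
  induction n with
  | zero => simp
  | succ n ih =>
    rw [ascPochhammer_succ_eval, Nat.cast_succ, ← add_assoc, Real.Gamma_add_one (by positivity),
      ih]
    ring

/-- The exponential rate `λ(s) = b / 2 * (1 + s²)` in Craig's representation of
`x ↦ gaussQ (√(b x))`. -/
def craigRate (b s : ℝ) : ℝ := b / 2 * (1 + s ^ 2)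

/-- The variable `λ / (1 + λ)` of the Laguerre generating function. -/
def craigWeight (b s : ℝ) : ℝ := craigRate b s / (1 + craigRate b s)

theorem craigRate_pos {b : ℝ} (hb : 0 < b) (s : ℝ) : 0 < craigRate b s := by
  unfold craigRate
  positivity

theorem measurable_craigWeight (b : ℝ) : Measurable (craigWeight b) := by
  unfold craigWeight craigRate
  fun_prop

theorem craigWeight_nonneg {b : ℝ} (hb : 0 < b) (s : ℝ) : 0 ≤ craigWeight b s := by
  have := craigRate_pos hb s
  unfold craigWeight
  positivity

theorem one_sub_craigWeight {b : ℝ} (hb : 0 < b) (s : ℝ) :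
    1 - craigWeight b s = (1 + b / 2 + b / 2 * s ^ 2)⁻¹ := by
  have := craigRate_pos hb s
  have h : 1 + b / 2 + b / 2 * s ^ 2 = 1 + craigRate b s := by
    unfold craigRate
    ring
  rw [h, craigWeight]
  field_simp
  ring

theorem craigWeight_lt_one {b : ℝ} (hb : 0 < b) (s : ℝ) : craigWeight b s < 1 := by
  have h := one_sub_craigWeight hb s
  have : 0 < (1 + b / 2 + b / 2 * s ^ 2)⁻¹ := by positivity
  linarith

theorem craigWeight_div_one_sub {b : ℝ} (hb : 0 < b) (s : ℝ) :
    craigWeight b s / (1 - craigWeight b s) = craigRate b s := by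
  have := craigRate_pos hb s
  unfold craigWeight
  field_simp
  ring

theorem craigMeasure_le_craigWeight_ne_zero {b : ℝ} (hb : 0 < b) (r : ℝ) (hr : r < 1) :
    craigMeasure {s | r ≤ craigWeight b s} ≠ 0 := by
  refine fun h => ?_
  have h0 := volume_absolutelyContinuous_craigMeasure h
  -- From here on `b / 2 * s² ≥ 1 / (1 - r)`, the summand `1` ensuring `s² ≥ s`; this half-line has
  -- infinite Lebesgue measure.
  have hsub : Set.Ici (1 + 2 / (b * (1 - r))) ⊆ {s | r ≤ craigWeight b s} := by
    intro s hs
    have hr' : 0 < 1 - r := by linarith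
    have hs' : 1 + 2 / (b * (1 - r)) ≤ s := hs
    have hq : 0 < 2 / (b * (1 - r)) := by positivity
    have h1 : 2 / (b * (1 - r)) ≤ s ^ 2 := by nlinarith
    rw [div_le_iff₀ (by positivity)] at h1
    have h2 : 1 - craigWeight b s ≤ 1 - r := by
      rw [one_sub_craigWeight hb]
      refine inv_le_of_inv_le₀ hr' ?_
      rw [inv_le_iff_one_le_mul₀ hr']
      nlinarith [mul_pos hb hr']
    show r ≤ craigWeight b s
    linarith
  have := measure_mono_null hsub h0
  simp at this

/-- With `q = 1 - u = (A + c s²)⁻¹` and `A = 1 + c`, one has `1 - q = c (1 + s²) q`. So the Cauchy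
factor `(1 + s²)⁻¹` is the geometric series `c ∑ qʲ⁺¹`, and termwise integration yields Gamma
quotients that form the `₂F₁` series. -/
theorem integral_one_sub_craigWeight_pow {b : ℝ} (hb : 0 < b) (k : ℕ) :
    ∫ s, (1 - craigWeight b s) ^ (k + 1) ∂craigMeasure =
      Real.sqrt (b / (8 * Real.pi)) * (1 / realPochhammer ((k : ℝ) + 3 / 2) (1 / 2) *
        (ordinaryHypergeometric (1 : ℝ) ((k : ℝ) + 3 / 2) ((k : ℝ) + 2) (1 / (1 + b / 2)) /
          (1 + b / 2) ^ ((k : ℝ) + 3 / 2))) := by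
  have hA : 0 < 1 + b / 2 := by positivity
  have hc : 0 < b / 2 := by positivity
  set A := 1 + b / 2 with hA_def
  set c := b / 2 with hc_def
  have hq0 : ∀ s : ℝ, 0 < (A + c * s ^ 2)⁻¹ := fun s => by positivity
  have hq1 : ∀ s : ℝ, (A + c * s ^ 2)⁻¹ < 1 := fun s => by
    refine inv_lt_one_of_one_lt₀ ?_
    nlinarith [mul_nonneg hc.le (sq_nonneg s)]
  have hgeom : ∀ s : ℝ, HasSum
      (fun j : ℕ => (2 * Real.pi)⁻¹ * c * ((A + c * s ^ 2)⁻¹) ^ (k + j + 1 + 1))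
      ((2 * Real.pi)⁻¹ * (1 + s ^ 2)⁻¹ * ((A + c * s ^ 2)⁻¹) ^ (k + 1)) := by
    intro s
    have h := (hasSum_geometric_of_lt_one (hq0 s).le (hq1 s)).mul_left
      ((2 * Real.pi)⁻¹ * c * ((A + c * s ^ 2)⁻¹) ^ (k + 2))
    convert! h using 1
    · ext j
      ring
    · have h1 : 1 - (A + c * s ^ 2)⁻¹ = c * (1 + s ^ 2) * (A + c * s ^ 2)⁻¹ := by
        have : (A + c * s ^ 2) ≠ 0 := by positivity
        field_simp
        rw [hA_def, hc_def]
        ring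
      have hne := (hq0 s).ne'
      rw [h1]
      generalize (A + c * s ^ 2)⁻¹ = q at hne
      field_simp
      ring
  have hintg : Integrable
      fun s : ℝ => (2 * Real.pi)⁻¹ * (1 + s ^ 2)⁻¹ * ((A + c * s ^ 2)⁻¹) ^ (k + 1) := by
    refine (integrable_inv_one_add_sq.const_mul (2 * Real.pi)⁻¹).mono' ?_
      (Eventually.of_forall fun s => ?_)
    · exact (integrable_inv_one_add_sq.const_mul _).aestronglyMeasurable.mul
        (integrable_inv_add_mul_sq_pow hA hc k).aestronglyMeasurable
    · have h0 := (hq0 s).le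
      rw [Real.norm_of_nonneg (by positivity)]
      exact mul_le_of_le_one_right (by positivity) (pow_le_one₀ h0 (hq1 s).le)
  have hsum := hasSum_integral_of_dominated_convergence (μ := volume)
    (F := fun (j : ℕ) (s : ℝ) => (2 * Real.pi)⁻¹ * c * ((A + c * s ^ 2)⁻¹) ^ (k + j + 1 + 1))
    (f := fun s : ℝ => (2 * Real.pi)⁻¹ * (1 + s ^ 2)⁻¹ * ((A + c * s ^ 2)⁻¹) ^ (k + 1))
    (fun j s => (2 * Real.pi)⁻¹ * c * ((A + c * s ^ 2)⁻¹) ^ (k + j + 1 + 1))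
    (fun j => ((integrable_inv_add_mul_sq_pow hA hc (k + j + 1)).const_mul
      _).aestronglyMeasurable)
    (fun j => Eventually.of_forall fun s => by
      have h0 := (hq0 s).le
      rw [Real.norm_of_nonneg (by positivity)])
    (Eventually.of_forall fun s => (hgeom s).summable)
    (hintg.congr (Eventually.of_forall fun s => (hgeom s).tsum_eq.symm))
    (Eventually.of_forall hgeom)
  rw [integral_craigMeasure]
  simp_rw [one_sub_craigWeight hb]
  rw [← hsum.tsum_eq, ordinaryHypergeometric_eq_tsum]
  simp only [smul_eq_mul]
  rw [← tsum_div_const, ← tsum_mul_left, ← tsum_mul_left]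
  refine tsum_congr fun j => ?_
  rw [integral_const_mul, integral_inv_add_mul_sq_pow hA hc, ascPochhammer_eval_one]
  have hsq : (2 * Real.pi)⁻¹ * c * Real.sqrt (Real.pi / c) = Real.sqrt (b / (8 * Real.pi)) := by
    have h0 : 0 ≤ (2 * Real.pi)⁻¹ * c := by positivity
    rw [← Real.sqrt_sq h0, ← Real.sqrt_mul (by positivity)]
    congr 1
    rw [hc_def]
    have := Real.pi_pos
    field_simp
    ring
  have hG1 : Real.Gamma (((k + j + 1 : ℕ) : ℝ) + 1 / 2) =
      (ascPochhammer ℝ j).eval ((k : ℝ) + 3 / 2) * Real.Gamma ((k : ℝ) + 3 / 2) := by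
    rw [← Gamma_add_nat_eq_ascPochhammer (by positivity)]
    congr 1
    push_cast
    ring
  have hG2 : Real.Gamma (((k + j + 1 : ℕ) : ℝ) + 1) =
      (ascPochhammer ℝ j).eval ((k : ℝ) + 2) * Real.Gamma ((k : ℝ) + 2) := by
    rw [← Gamma_add_nat_eq_ascPochhammer (by positivity)]
    congr 1
    push_cast
    ring
  have hpow : A ^ (((k + j + 1 : ℕ) : ℝ) + 1 / 2) = A ^ ((k : ℝ) + 3 / 2) * A ^ j := by
    rw [← Real.rpow_natCast A j, ← Real.rpow_add hA]
    congr 1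
    push_cast
    ring
  rw [hG1, hG2, hpow, realPochhammer, one_div A, inv_pow,
    show (k : ℝ) + 3 / 2 + 1 / 2 = (k : ℝ) + 2 by ring, ← hsq]
  have h1 : Real.Gamma ((k : ℝ) + 3 / 2) ≠ 0 := (Real.Gamma_pos_of_pos (by positivity)).ne'
  have h2 : Real.Gamma ((k : ℝ) + 2) ≠ 0 := (Real.Gamma_pos_of_pos (by positivity)).ne'
  have h3 : (ascPochhammer ℝ j).eval ((k : ℝ) + 2) ≠ 0 :=
    (ascPochhammer_pos j _ (by positivity)).ne'
  have h4 : A ^ ((k : ℝ) + 3 / 2) ≠ 0 := by positivity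
  have h5 : (j.factorial : ℝ) ≠ 0 := by positivity
  have h6 : A ≠ 0 := hA.ne'
  generalize A ^ ((k : ℝ) + 3 / 2) = w at h4 ⊢
  generalize Real.sqrt (Real.pi / c) = y
  field_simp

/-- Binomial expansion of `uⁿ = (1 - (1 - u))ⁿ`. -/
theorem integral_craigWeight_pow_mul {b : ℝ} (hb : 0 < b) (n : ℕ) :
    ∫ s, craigWeight b s ^ n * (1 - craigWeight b s) ∂craigMeasure =
      Real.sqrt (b / (8 * Real.pi)) * berInnerSum b n := by
  have hi : ∀ k : ℕ, Integrable (fun s => (1 - craigWeight b s) ^ (k + 1)) craigMeasure := by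
    intro k
    have hm := measurable_craigWeight b
    refine Integrable.mono' (integrable_const (1 : ℝ)) (by fun_prop)
      (Eventually.of_forall fun s => ?_)
    have h0 := craigWeight_nonneg hb s
    have h1 := craigWeight_lt_one hb s
    have h2 : 0 ≤ 1 - craigWeight b s := by linarith
    rw [Real.norm_of_nonneg (by positivity)]
    exact pow_le_one₀ h2 (by linarith)
  have hexpand : ∀ s, craigWeight b s ^ n * (1 - craigWeight b s) =
      ∑ k ∈ Finset.range (n + 1), (-1) ^ k * (n.choose k : ℝ) *
        (1 - craigWeight b s) ^ (k + 1) := by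
    intro s
    have h := add_pow (-(1 - craigWeight b s)) 1 n
    rw [show -(1 - craigWeight b s) + 1 = craigWeight b s by ring] at h
    rw [h, Finset.sum_mul]
    refine Finset.sum_congr rfl fun k _ => ?_
    rw [neg_pow]
    ring
  simp_rw [hexpand]
  rw [integral_finsetSum _ fun k _ => (hi k).const_mul _, berInnerSum, Finset.mul_sum]
  refine Finset.sum_congr rfl fun k _ => ?_
  rw [integral_const_mul, integral_one_sub_craigWeight_pow hb]
  ring

theorem gaussQ_sqrt_mul {b x : ℝ} (hb : 0 < b) (hx : 0 ≤ x) :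
    gaussQ (Real.sqrt (b * x)) =
      ∫ s, Real.exp (-(craigWeight b s / (1 - craigWeight b s)) * x) ∂craigMeasure := by
  rw [gaussQ_eq_integral_craigMeasure (Real.sqrt_nonneg _), Real.sq_sqrt (by positivity)]
  refine integral_congr_ae (Eventually.of_forall fun s => ?_)
  simp only
  rw [craigWeight_div_one_sub hb, craigRate]
  ring_nf

/-! ### Exponential moments of the fading laws and of the envelope. -/

theorem integrable_exp_mul_sq_nakagamiMeasure {m Ω c : ℝ} (hm : 0 < m) (hc : c < m / Ω) :
    Integrable (fun x => Real.exp (c * x ^ 2)) (nakagamiMeasure m Ω) := by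
  have hmeas : Measurable fun x : ℝ => ENNReal.ofReal
      (if 0 < x then
        2 / Real.Gamma m * (m / Ω) ^ m * x ^ (2 * m - 1) * Real.exp (-(m / Ω) * x ^ 2)
      else 0) :=
    (Measurable.ite measurableSet_Ioi (by fun_prop) measurable_const).ennreal_ofReal
  rw [nakagamiMeasure, integrable_withDensity_iff_integrable_smul' hmeas
    (Eventually.of_forall fun _ => ENNReal.ofReal_lt_top)]
  -- The absolute value covers a possibly negative `(m / Ω) ^ m`, as `Ω` carries no sign condition
  -- here.
  refine ((integrable_rpow_mul_exp_neg_mul_sq (b := m / Ω - c) (by linarith)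
    (s := 2 * m - 1) (by linarith)).const_mul
      (2 / Real.Gamma m * |(m / Ω) ^ m|)).norm.mono' ?_ (Eventually.of_forall fun x => ?_)
  · exact (hmeas.ennreal_toReal.smul (by fun_prop)).aestronglyMeasurable
  · have hG : 0 < Real.Gamma m := Real.Gamma_pos_of_pos hm
    rw [smul_eq_mul, norm_mul, Real.norm_of_nonneg ENNReal.toReal_nonneg,
      Real.norm_of_nonneg (Real.exp_pos _).le]
    split_ifs with hx
    · have hE : Real.exp (-(m / Ω - c) * x ^ 2) =
          Real.exp (-(m / Ω) * x ^ 2) * Real.exp (c * x ^ 2) := by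
        rw [← Real.exp_add]
        ring_nf
      have hxp : 0 < x ^ (2 * m - 1) := Real.rpow_pos_of_pos hx _
      rw [hE, Real.norm_of_nonneg (by positivity)]
      calc _ ≤ 2 / Real.Gamma m * |(m / Ω) ^ m| * x ^ (2 * m - 1) *
            Real.exp (-(m / Ω) * x ^ 2) * Real.exp (c * x ^ 2) := by
            refine mul_le_mul_of_nonneg_right ?_ (Real.exp_pos _).le
            refine ENNReal.toReal_le_of_le_ofReal (by positivity) (ENNReal.ofReal_le_ofReal ?_)
            gcongr
            exact le_abs_self _
        _ = _ := by ring
    · simp only [ENNReal.ofReal_zero, ENNReal.toReal_zero, zero_mul]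
      exact norm_nonneg _

theorem integrable_exp_mul_sqrt_sq_gammaMeasure {a r c : ℝ} (ha : 0 < a) (hr : 0 < r)
    (hc : c < r) :
    Integrable (fun x => Real.exp (c * Real.sqrt x ^ 2)) (gammaMeasure a r) := by
  have hmeas : Measurable (gammaPDF a r) := (measurable_gammaPDFReal a r).ennreal_ofReal
  rw [gammaMeasure, integrable_withDensity_iff_integrable_smul' hmeas
    (Eventually.of_forall fun _ => ENNReal.ofReal_lt_top)]
  have h := (integrableOn_rpow_mul_exp_neg_mul_rpow (p := 1) (s := a - 1) (b := r - c)
    (by linarith) one_pos (by linarith)).const_mul (r ^ a / Real.Gamma a)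
  change IntegrableOn _ _ _ at h
  rw [← integrableOn_Ici_iff_integrableOn_Ioi, ← integrable_indicator_iff measurableSet_Ici] at h
  refine h.congr (Eventually.of_forall fun x => ?_)
  have hG : 0 < Real.Gamma a := Real.Gamma_pos_of_pos ha
  simp only [gammaPDF, gammaPDFReal, Set.indicator_apply, Set.mem_Ici, smul_eq_mul]
  split_ifs with hx
  · rw [ENNReal.toReal_ofReal (by positivity), Real.rpow_one, Real.sq_sqrt hx,
      mul_assoc (r ^ a / Real.Gamma a * x ^ (a - 1)), ← Real.exp_add]
    ring_nf
  · simp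

theorem norm_sum_mul_exp_add_le {N : ℕ} (w φ : Fin N → ℝ) (v ψ : ℝ) :
    ‖∑ i, (w i : ℂ) * Complex.exp (Complex.I * φ i) + (v : ℂ) * Complex.exp (Complex.I * ψ)‖ ≤
      ∑ i, |w i| + |v| := by
  have h : ∀ x y : ℝ, ‖(x : ℂ) * Complex.exp (Complex.I * y)‖ = |x| := fun x y => by
    rw [mul_comm Complex.I, norm_mul, Complex.norm_exp_ofReal_mul_I, Complex.norm_real, mul_one,
      Real.norm_eq_abs]
  refine (norm_add_le _ _).trans ?_
  rw [h]
  gcongr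
  refine (norm_sum_le _ _).trans ?_
  simp_rw [h]
  exact le_rfl

theorem add_sq_le_div_add_div {θ : ℝ} (h0 : 0 < θ) (h1 : θ < 1) (p q : ℝ) :
    (p + q) ^ 2 ≤ p ^ 2 / θ + q ^ 2 / (1 - θ) := by
  have h2 : 0 < 1 - θ := by linarith
  rw [div_add_div _ _ h0.ne' h2.ne', le_div_iff₀ (by positivity)]
  nlinarith [sq_nonneg ((1 - θ) * p - θ * q)]

/-- Separates the specular part from the diffuse part `v`, with a free weight `θ` shared between
them; `y` is `1` for MWGD and `√ξ` for FMR. -/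
theorem exp_envelope_sq_le {a T θ R y L v : ℝ} (ha : 0 ≤ a) (hT : 0 < T) (h0 : 0 < θ)
    (h1 : θ < 1) (hR0 : 0 ≤ R) (hR : R ≤ y * L + |v|) :
    Real.exp (a * (1 / T * R ^ 2)) ≤
      Real.exp (a * L ^ 2 / T / θ * y ^ 2) * Real.exp (a / T / (1 - θ) * v ^ 2) := by
  rw [← Real.exp_add]
  refine Real.exp_le_exp.2 ?_
  have h2 : 0 < 1 - θ := by linarith
  calc a * (1 / T * R ^ 2) ≤ a * (1 / T * ((y * L) ^ 2 / θ + |v| ^ 2 / (1 - θ))) := by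
        gcongr
        exact (pow_le_pow_left₀ hR0 hR 2).trans (add_sq_le_div_add_div h0 h1 _ _)
    _ = _ := by
        rw [sq_abs]
        field_simp

section Envelope

variable {S : Type*} [MeasurableSpace S] {P : Measure S} {N : ℕ} {V : Fin N → ℝ}
  {m Ω : ℝ} {R : S → ℝ}

theorem totalPower_pos (V : Fin N → ℝ) (hΩ : 0 < Ω) : 0 < totalPower V Ω := by
  unfold totalPower
  positivity

theorem IsMWGDEnvelope.aemeasurable (h : IsMWGDEnvelope P V m Ω R) : AEMeasurable R P := by
  obtain ⟨φ, φd, Vd, hφ, hφd, hVd, -, hR⟩ := h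
  have h1 := fun i => (hφ i).aemeasurable
  have h2 := hφd.aemeasurable
  have h3 := hVd.aemeasurable
  refine AEMeasurable.congr ?_ (EventuallyEq.symm hR)
  fun_prop

theorem IsFMREnvelope.aemeasurable {ms : ℝ} (h : IsFMREnvelope P V m Ω ms R) :
    AEMeasurable R P := by
  obtain ⟨φ, φd, Vd, ξ, hφ, hφd, hVd, hξ, -, hR⟩ := h
  have h1 := fun i => (hφ i).aemeasurable
  have h2 := hφd.aemeasurable
  have h3 := hVd.aemeasurable
  have h4 := hξ.aemeasurable
  refine AEMeasurable.congr ?_ (EventuallyEq.symm hR)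
  fun_prop

theorem IsMWGDEnvelope.integrable_exp (hV : ∀ i, 0 ≤ V i) (hm : 0 < m) (hΩ : 0 < Ω)
    (h : IsMWGDEnvelope P V m Ω R) {a : ℝ} (ha : 0 ≤ a) (haT : a * (Ω / m) < totalPower V Ω) :
    Integrable (fun s => Real.exp (a * (1 / totalPower V Ω * R s ^ 2))) P := by
  have hR' := h.aemeasurable
  have hT := totalPower_pos V hΩ
  set T := totalPower V Ω
  obtain ⟨φ, φd, Vd, hφ, hφd, hVd, -, hR⟩ := h
  set B := a * (Ω / m) / T with hB
  have hB0 : 0 ≤ B := by positivity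
  have hB1 : B < 1 := by rwa [hB, div_lt_one hT]
  -- Here `θ = (1 - B) / 2`; the Nakagami moment needs `B < 1 - θ`, while the specular part is
  -- bounded, so any such positive `θ` serves.
  have hnak := integrable_exp_mul_sq_nakagamiMeasure (Ω := Ω)
    (c := a / T / (1 - (1 - B) / 2)) hm (by
      rw [div_lt_div_iff₀ (by linarith) hΩ]
      have : a / T * Ω = m * B := by rw [hB]; field_simp
      rw [this]
      nlinarith)
  rw [← hVd.map_eq] at hnak
  have hi := hnak.comp_aemeasurable hVd.aemeasurable
  refine (hi.const_mul (Real.exp (a * (∑ i, V i) ^ 2 / T / ((1 - B) / 2) * 1 ^ 2))).mono'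
    (by fun_prop) ?_
  filter_upwards [hR] with s hs
  rw [Real.norm_of_nonneg (Real.exp_pos _).le]
  refine exp_envelope_sq_le ha hT (by linarith) (by linarith) (hs ▸ norm_nonneg _) ?_
  rw [hs]
  refine (norm_sum_mul_exp_add_le _ _ _ _).trans (le_of_eq ?_)
  rw [one_mul]
  congr 1
  exact Finset.sum_congr rfl fun i _ => abs_of_nonneg (hV i)

theorem IsFMREnvelope.integrable_exp {ms : ℝ} (hV : ∀ i, 0 ≤ V i) (hm : 0 < m) (hΩ : 0 < Ω)
    (hms : 0 < ms) (h : IsFMREnvelope P V m Ω ms R) {a : ℝ} (ha : 0 ≤ a)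
    (haT : a * ((∑ i, V i) ^ 2 / ms + Ω / m) < totalPower V Ω) :
    Integrable (fun s => Real.exp (a * (1 / totalPower V Ω * R s ^ 2))) P := by
  have hR' := h.aemeasurable
  have hT := totalPower_pos V hΩ
  set T := totalPower V Ω
  set L := ∑ i, V i
  obtain ⟨φ, φd, Vd, ξ, hφ, hφd, hVd, hξ, hind, hR⟩ := h
  set A := a * (L ^ 2 / ms) / T with hA
  set B := a * (Ω / m) / T with hB
  have hA0 : 0 ≤ A := by positivity
  have hB0 : 0 ≤ B := by positivity
  have hAB : A + B < 1 := by rwa [hA, hB, ← add_div, ← mul_add, div_lt_one hT]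
  -- The midpoint of `A` and `1 - B`: `A < θ` gives the Gamma moment and `B < 1 - θ` the Nakagami
  -- moment.
  set θ := (A + (1 - B)) / 2 with hθ
  have hθ0 : 0 < θ := by linarith
  have hθ1 : θ < 1 := by linarith
  have hnak := integrable_exp_mul_sq_nakagamiMeasure (Ω := Ω)
    (c := a / T / (1 - θ)) hm (by
      rw [div_lt_div_iff₀ (by linarith) hΩ]
      have : a / T * Ω = m * B := by rw [hB]; field_simp
      rw [this]
      exact mul_lt_mul_of_pos_left (by linarith) hm)
  have hgam := integrable_exp_mul_sqrt_sq_gammaMeasure (c := a * L ^ 2 / T / θ) hms hms (by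
      rw [div_lt_iff₀ hθ0]
      have : a * L ^ 2 / T = ms * A := by rw [hA]; field_simp
      rw [this]
      exact mul_lt_mul_of_pos_left (by linarith) hms)
  rw [← hVd.map_eq] at hnak
  rw [← hξ.map_eq] at hgam
  have hi1 := hnak.comp_aemeasurable hVd.aemeasurable
  have hi2 := hgam.comp_aemeasurable hξ.aemeasurable
  have hpair : IndepFun ξ Vd P := hind.indepFun (i := Sum.inr 2) (j := Sum.inr 1) (by simp)
  have hpair' := hpair.comp
    (φ := fun x : ℝ => Real.exp (a * L ^ 2 / T / θ * Real.sqrt x ^ 2))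
    (ψ := fun x : ℝ => Real.exp (a / T / (1 - θ) * x ^ 2)) (by fun_prop) (by fun_prop)
  refine (hpair'.integrable_mul hi2 hi1).mono' (by fun_prop) ?_
  filter_upwards [hR] with s hs
  rw [Real.norm_of_nonneg (Real.exp_pos _).le]
  refine exp_envelope_sq_le (y := Real.sqrt (ξ s)) (v := Vd s) ha hT hθ0 hθ1
    (hs ▸ norm_nonneg _) ?_
  rw [hs]
  have hle := norm_sum_mul_exp_add_le (fun i => Real.sqrt (ξ s) * V i) (fun i => φ i s)
    (Vd s) (φd s)
  push_cast at hle
  refine hle.trans (le_of_eq ?_)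
  congr 1
  rw [Finset.mul_sum]
  exact Finset.sum_congr rfl fun i _ => abs_of_nonneg (mul_nonneg (Real.sqrt_nonneg _) (hV i))

end Envelope

/-! ### The average bit error rate. -/

section AverageBER

variable {S : Type*} [MeasurableSpace S] {P : Measure S} {N : ℕ} {V : Fin N → ℝ}
  {Ω γ₀ : ℝ} {R : S → ℝ}

theorem gaussQ_sqrt_mul_eq_scaled (hΩ : 0 < Ω) (β x : ℝ) :
    gaussQ (Real.sqrt (β * (γ₀ * x ^ 2))) =
      gaussQ (Real.sqrt (β * avgSNR V Ω γ₀ * (1 / totalPower V Ω * x ^ 2))) := by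
  have hT := totalPower_pos V hΩ
  congr 2
  rw [avgSNR]
  field_simp

theorem integral_instBER_eq_of_tendsto [IsProbabilityMeasure P] (hΩ : 0 < Ω) (hγ₀ : 0 < γ₀)
    {M : ℕ} (α β : Fin M → ℝ) (hβ : ∀ r, 0 < β r) (hR : AEMeasurable R P) {δ : ℝ} (hδ : 0 < δ)
    (hexp : Integrable (fun s => Real.exp (δ * (1 / totalPower V Ω * R s ^ 2))) P)
    {σ : Fin M → ℝ} (hσ : ∀ r, Tendsto (fun n : ℕ => ∑ j ∈ Finset.range n,
      laguerreCoeff P V Ω R j * berInnerSum (β r * avgSNR V Ω γ₀) j) atTop (𝓝 (σ r))) :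
    ∫ s, instBER α β (γ₀ * R s ^ 2) ∂P =
      ∑ r, α r * Real.sqrt (β r * avgSNR V Ω γ₀ / (8 * Real.pi)) * σ r := by
  have hT := totalPower_pos V hΩ
  have hb : ∀ r, 0 < β r * avgSNR V Ω γ₀ := fun r => mul_pos (hβ r) (mul_pos hγ₀ hT)
  have hX : AEMeasurable (fun s => 1 / totalPower V Ω * R s ^ 2) P := by fun_prop
  have hX0 : ∀ s, 0 ≤ 1 / totalPower V Ω * R s ^ 2 := fun s => by positivity
  simp only [instBER, gaussQ_sqrt_mul_eq_scaled (V := V) (γ₀ := γ₀) hΩ]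
  simp_rw [fun r s => gaussQ_sqrt_mul (hb r) (hX0 s)]
  rw [integral_finsetSum]
  · refine Finset.sum_congr rfl fun r _ => ?_
    rw [integral_const_mul, mul_assoc]
    congr 1
    refine integral_integral_exp_eq_of_tendsto hX (Eventually.of_forall hX0) hδ hexp
      (measurable_craigWeight _) (craigWeight_nonneg (hb r)) (craigWeight_lt_one (hb r))
      (craigMeasure_le_craigWeight_ne_zero (hb r)) ?_
    refine ((hσ r).const_mul _).congr fun n => ?_
    rw [Finset.mul_sum]
    refine Finset.sum_congr rfl fun j _ => ?_
    rw [integral_craigWeight_pow_mul (hb r), laguerreCoeff]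
    ring
  · intro r _
    have hmeas := measurable_craigWeight (β r * avgSNR V Ω γ₀)
    exact (integrable_exp_neg_mul_prod (ν := craigMeasure) hX (Eventually.of_forall hX0)
      (l := fun t => craigWeight (β r * avgSNR V Ω γ₀) t /
        (1 - craigWeight (β r * avgSNR V Ω γ₀) t)) (by fun_prop)
      fun t => div_nonneg (craigWeight_nonneg (hb r) t)
        (by linarith [craigWeight_lt_one (hb r) t])).integral_prod_left.const_mul _

theorem summable_laguerreCoeff_mul_berInnerSum [IsFiniteMeasure P] (hΩ : 0 < Ω) {b : ℝ}
    (hb : 0 < b) (hR : AEMeasurable R P)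
    (hexp : Integrable (fun s => Real.exp (1 / 2 * (1 / totalPower V Ω * R s ^ 2))) P) :
    Summable fun n : ℕ => laguerreCoeff P V Ω R n * berInnerSum b n := by
  have hT := totalPower_pos V hΩ
  have h := summable_integral_laguerreL_mul (ν := craigMeasure)
    (X := fun s => 1 / totalPower V Ω * R s ^ 2) (by fun_prop)
    (Eventually.of_forall fun s => by positivity) hexp (measurable_craigWeight b)
    (craigWeight_nonneg hb) (craigWeight_lt_one hb)
  have hs : Real.sqrt (b / (8 * Real.pi)) ≠ 0 := by positivity
  refine (h.mul_left (Real.sqrt (b / (8 * Real.pi)))⁻¹).congr fun n => ?_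
  rw [integral_craigWeight_pow_mul hb, laguerreCoeff]
  field_simp

end AverageBER

end

theorem mainTheorem6 {S : Type*} [MeasurableSpace S] (P : Measure S) [IsProbabilityMeasure P]
    {N : ℕ} (V : Fin N → ℝ) (hV : ∀ i, 0 ≤ V i)
    (m Ω γ₀ : ℝ) (hm : 0 < m) (hΩ : 0 < Ω) (hγ₀ : 0 < γ₀)
    {M : ℕ} (α β : Fin M → ℝ) (hβ : ∀ r, 0 < β r) (R : S → ℝ) :
    -- both models, all parameters: the formula holds whenever its series over `n` converge
    ((IsMWGDEnvelope P V m Ω R ∨ ∃ ms : ℝ, 0 < ms ∧ IsFMREnvelope P V m Ω ms R) →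
      ∀ σ : Fin M → ℝ,
        (∀ r, Tendsto (fun n : ℕ => ∑ j ∈ Finset.range n,
          laguerreCoeff P V Ω R j * berInnerSum (β r * avgSNR V Ω γ₀) j) atTop (𝓝 (σ r))) →
        ∫ s, instBER α β (γ₀ * R s ^ 2) ∂P =
          ∑ r, α r * Real.sqrt (β r * avgSNR V Ω γ₀ / (8 * Real.pi)) * σ r) ∧
    -- the series do converge, absolutely, in the following ranges of the parameters
    (((IsMWGDEnvelope P V m Ω R ∧ Ω < 2 * m * totalPower V Ω) ∨
        ∃ ms : ℝ, 0 < ms ∧ IsFMREnvelope P V m Ω ms R ∧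
          (∑ i, V i) ^ 2 < ms * (2 * totalPower V Ω - Ω / m)) →
      (∀ r, Summable fun n : ℕ =>
        laguerreCoeff P V Ω R n * berInnerSum (β r * avgSNR V Ω γ₀) n) ∧
      ∫ s, instBER α β (γ₀ * R s ^ 2) ∂P =
        ∑ r, α r * Real.sqrt (β r * avgSNR V Ω γ₀ / (8 * Real.pi)) *
          ∑' n : ℕ, laguerreCoeff P V Ω R n * berInnerSum (β r * avgSNR V Ω γ₀) n) := by
  have hT := totalPower_pos V hΩ
  refine ⟨fun h σ hσ => ?_, fun h => ?_⟩
  · rcases h with h | ⟨ms, hms, h⟩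
    -- Any small positive `δ` works; the `+ 1` in its denominator makes `δ * (Ω / m)` strictly less
    -- than the total power.
    · refine integral_instBER_eq_of_tendsto hΩ hγ₀ α β hβ h.aemeasurable
        (δ := totalPower V Ω / (Ω / m + 1)) (by positivity)
        (h.integrable_exp hV hm hΩ (by positivity) ?_) hσ
      rw [div_mul_eq_mul_div, div_lt_iff₀ (by positivity)]
      linarith
    · refine integral_instBER_eq_of_tendsto hΩ hγ₀ α β hβ h.aemeasurable
        (δ := totalPower V Ω / ((∑ i, V i) ^ 2 / ms + Ω / m + 1)) (by positivity)
        (h.integrable_exp hV hm hΩ hms (by positivity) ?_) hσ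
      rw [div_mul_eq_mul_div, div_lt_iff₀ (by positivity)]
      linarith
  -- The parameter ranges are the moment conditions `a * (…) < totalPower V Ω` at `a = 1/2`.
  · have hexp : AEMeasurable R P ∧
        Integrable (fun s => Real.exp (1 / 2 * (1 / totalPower V Ω * R s ^ 2))) P := by
      rcases h with ⟨h, hlt⟩ | ⟨ms, hms, h, hlt⟩
      · refine ⟨h.aemeasurable, h.integrable_exp hV hm hΩ (by norm_num) ?_⟩
        have : Ω / m < 2 * totalPower V Ω := by
          rw [div_lt_iff₀ hm]
          linarith
        linarith
      · refine ⟨h.aemeasurable, h.integrable_exp hV hm hΩ hms (by norm_num) ?_⟩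
        have : (∑ i, V i) ^ 2 / ms < 2 * totalPower V Ω - Ω / m := by
          rw [div_lt_iff₀ hms]
          linarith
        linarith
    have hsum := fun r => summable_laguerreCoeff_mul_berInnerSum (b := β r * avgSNR V Ω γ₀) hΩ
      (mul_pos (hβ r) (mul_pos hγ₀ hT)) hexp.1 hexp.2
    exact ⟨hsum, integral_instBER_eq_of_tendsto hΩ hγ₀ α β hβ hexp.1 (by norm_num) hexp.2
      fun r => (hsum r).hasSum.tendsto_sum_nat⟩
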